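/- Consider the problem MINSUMOFRATIOS. An instance consists of $2n$ pairwise distinct points $c_1,\dots,c_{2n}$ (cameras) lying on a line $l$ in the Euclidean plane, and $n$ points $t_1,\dots,t_n$ (targets) in the plane. A feasible solution assigns to each target a pair of cameras so that every camera is assigned to exactly one target. If target $t_k$ is assigned the cameras $c_i,c_j$, its aspect ratio is $Z_k/b_{i,j}$, where $Z_k$ is the distance from $t_k$ to $l$ and $b_{i,j}=|c_i-c_j|$; the cost of a solution is the sum of the aspect ratios of its $n$ targets, and it is to be minimized. **Theorem.** There is a single algorithm (a finite program with exact real arithmetic, comparisons of reals and recursion, each elementary operation costing one step) which, given any parameter $0<\varepsilon<1$ and any instance of MINSUMOFRATIOS with $2n$ cameras and $n$ targets, returns a feasible solution whose cost is at most $(1+\varepsilon)$ times the cost of an optimal solution, and which runs in quasi-polynomial time: there is an absolute constant $d$ and, for each $\varepsilon$, a constant $C_\varepsilon$ such that on every instance the number of steps is at most $(n+2)^{C_\varepsilon (\log (n+2))^{d}}$. -/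

import Mathlib

/-! ## The problem MINSUMOFRATIOS -/

/-- The Euclidean plane. -/
abbrev Plane : Type := EuclideanSpace ℝ (Fin 2)

/-- A feasible solution for `n` targets and `2 * n` cameras: target `k` is assigned to the two
cameras `fst k` and `snd k`, and each camera is assigned to exactly one target (and used there
exactly once). -/
structure CameraAssignment (n : ℕ) where
  fst : Fin n → Fin (2 * n)
  snd : Fin n → Fin (2 * n)
  bijective : Function.Bijective (Sum.elim fst snd)

/-- The depth `Z` of a target: its distance from the line spanned by the cameras. -/
noncomputable def depth {n : ℕ} (c : Fin (2 * n) → Plane) (p : Plane) : ℝ :=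
  Metric.infDist p (affineSpan ℝ (Set.range c) : Set Plane)

/-- The sum of aspect ratios `Z_k / b_{i,j}` of an assignment, where `b_{i,j}` is the distance of
the two cameras assigned to target `k`. -/
noncomputable def sumOfRatios {n : ℕ} (c : Fin (2 * n) → Plane) (t : Fin n → Plane)
    (A : CameraAssignment n) : ℝ :=
  ∑ k, depth c (t k) / dist (c (A.fst k)) (c (A.snd k))

/-! ## The model of computation

A uniform algorithm is a finite program that works on data built from exact real numbers and
pairs (binary cells), with arithmetic on reals (no rounding), comparison of reals, and recursive
procedures. Every rule below costs one step and is a constant number of operations of a real RAM: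
data are passed by reference, and the environment has length bounded in terms of the program. -/

/-- Data: the empty value, a real number, or a cell with two components. -/
inductive Val : Type
  | nil : Val
  | num (x : ℝ) : Val
  | cons (a b : Val) : Val

/-- The arithmetic operations. -/
inductive ArithOp : Type
  | add | sub | mul | div

/-- The real number computed by an arithmetic operation. -/
noncomputable def ArithOp.eval : ArithOp → ℝ → ℝ → ℝ
  | .add, x, y => x + y
  | .sub, x, y => x - y
  | .mul, x, y => x * y
  | .div, x, y => x / y

/-- Program expressions. The only constants are rational. Variables are de Bruijn indices. -/
inductive Expr : Type
  /-- the value of a local variable -/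
  | var (i : ℕ)
  /-- a rational constant -/
  | const (q : ℚ)
  /-- the empty value -/
  | nil
  /-- a new cell -/
  | cons (a b : Expr)
  /-- an arithmetic operation on two real numbers -/
  | op (o : ArithOp) (a b : Expr)
  /-- `if a ≤ b then d else e`, for real numbers `a` and `b` -/
  | ifLE (a b d e : Expr)
  /-- `match a with | cell x y => d | nil => e`; in `d`, variable `0` is `x` and variable `1`
  is `y` -/
  | split (a d e : Expr)
  /-- `let x := a; d`; in `d`, variable `0` is `x` -/
  | bind (a d : Expr)
  /-- the call of procedure number `f` with argument `a` -/
  | call (f : ℕ) (a : Expr)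

/-- A program: a finite list of (mutually recursive) procedure bodies, in each of which variable
`0` is the argument, and a main expression, in which variable `0` is the input. -/
structure Program where
  procs : List Expr
  main : Expr

/-- `Eval P env e v s`: in the environment `env`, and with the procedures `P`, the evaluation of
`e` halts after exactly `s` steps with the value `v`. There is no rule for an ill-typed operation
or for a division by zero: such an evaluation has no value. -/
inductive Eval (P : List Expr) : List Val → Expr → Val → ℕ → Prop
  | var {env : List Val} {i : ℕ} {v : Val} :
      env[i]? = some v → Eval P env (.var i) v 1
  | const {env : List Val} {q : ℚ} :
      Eval P env (.const q) (.num q) 1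
  | nil {env : List Val} :
      Eval P env .nil .nil 1
  | cons {env : List Val} {a b : Expr} {v w : Val} {s t : ℕ} :
      Eval P env a v s → Eval P env b w t →
      Eval P env (.cons a b) (.cons v w) (s + t + 1)
  | op {env : List Val} {o : ArithOp} {a b : Expr} {x y : ℝ} {s t : ℕ} :
      Eval P env a (.num x) s → Eval P env b (.num y) t → (o = .div → y ≠ 0) →
      Eval P env (.op o a b) (.num (o.eval x y)) (s + t + 1)
  | ifLE_true {env : List Val} {a b d e : Expr} {x y : ℝ} {v : Val} {s t r : ℕ} :
      Eval P env a (.num x) s → Eval P env b (.num y) t → x ≤ y → Eval P env d v r →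
      Eval P env (.ifLE a b d e) v (s + t + r + 1)
  | ifLE_false {env : List Val} {a b d e : Expr} {x y : ℝ} {v : Val} {s t r : ℕ} :
      Eval P env a (.num x) s → Eval P env b (.num y) t → y < x → Eval P env e v r →
      Eval P env (.ifLE a b d e) v (s + t + r + 1)
  | split_cons {env : List Val} {a d e : Expr} {x y v : Val} {s t : ℕ} :
      Eval P env a (.cons x y) s → Eval P (x :: y :: env) d v t →
      Eval P env (.split a d e) v (s + t + 1)
  | split_nil {env : List Val} {a d e : Expr} {v : Val} {s t : ℕ} :
      Eval P env a .nil s → Eval P env e v t →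
      Eval P env (.split a d e) v (s + t + 1)
  | bind {env : List Val} {a d : Expr} {x v : Val} {s t : ℕ} :
      Eval P env a x s → Eval P (x :: env) d v t →
      Eval P env (.bind a d) v (s + t + 1)
  | call {env : List Val} {f : ℕ} {a body : Expr} {x v : Val} {s t : ℕ} :
      Eval P env a x s → P[f]? = some body → Eval P [x] body v t →
      Eval P env (.call f a) v (s + t + 1)

/-- On input `x` the program halts after exactly `s` steps with output `y`. -/
def Program.Runs (P : Program) (x y : Val) (s : ℕ) : Prop :=
  Eval P.procs [x] P.main y s

/-- Evaluation is deterministic: the value and the number of steps are unique. -/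
theorem Eval.unique {P : List Expr} {env : List Val} {e : Expr} {v w : Val} {s t : ℕ}
    (h : Eval P env e v s) (h' : Eval P env e w t) : v = w ∧ s = t := by
  induction h generalizing w t with
  | var hi => cases h' with | var hj => simp_all
  | const => cases h'; simp
  | nil => cases h'; simp
  | cons _ _ ih1 ih2 =>
    cases h' with | cons k1 k2 => have := ih1 k1; have := ih2 k2; simp_all
  | op _ _ _ ih1 ih2 =>
    cases h' with | op k1 k2 _ => have := ih1 k1; have := ih2 k2; simp_all
  | ifLE_true _ _ hle _ ih1 ih2 ih3 =>
    cases h' with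
    | ifLE_true k1 k2 _ k3 => have := ih1 k1; have := ih2 k2; have := ih3 k3; simp_all
    | ifLE_false k1 k2 hlt k3 =>
      have h1 := (ih1 k1).1; have h2 := (ih2 k2).1
      simp only [Val.num.injEq] at h1 h2
      subst h1 h2
      exact absurd hle (not_le.mpr hlt)
  | ifLE_false _ _ hlt _ ih1 ih2 ih3 =>
    cases h' with
    | ifLE_false k1 k2 _ k3 => have := ih1 k1; have := ih2 k2; have := ih3 k3; simp_all
    | ifLE_true k1 k2 hle k3 =>
      have h1 := (ih1 k1).1; have h2 := (ih2 k2).1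
      simp only [Val.num.injEq] at h1 h2
      subst h1 h2
      exact absurd hle (not_le.mpr hlt)
  | split_cons _ _ ih1 ih2 =>
    cases h' with
    | split_cons k1 k2 =>
      obtain ⟨h1, rfl⟩ := ih1 k1
      simp only [Val.cons.injEq] at h1
      obtain ⟨rfl, rfl⟩ := h1
      obtain ⟨rfl, rfl⟩ := ih2 k2
      simp
    | split_nil k1 k2 => have := (ih1 k1).1; simp at this
  | split_nil _ _ ih1 ih2 =>
    cases h' with
    | split_nil k1 k2 => have := ih1 k1; have := ih2 k2; simp_all
    | split_cons k1 k2 => have := (ih1 k1).1; simp at this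
  | bind _ _ ih1 ih2 =>
    cases h' with
    | bind k1 k2 =>
      obtain ⟨rfl, rfl⟩ := ih1 k1
      obtain ⟨rfl, rfl⟩ := ih2 k2
      simp
  | call _ hb _ ih1 ih2 =>
    cases h' with
    | call k1 hb' k2 =>
      obtain ⟨rfl, rfl⟩ := ih1 k1
      rw [hb] at hb'
      obtain rfl := Option.some.inj hb'
      obtain ⟨rfl, rfl⟩ := ih2 k2
      simp

/-! ## Input and output formats -/

/-- A list of data as a chain of cells. -/
def Val.ofList : List Val → Val
  | [] => .nil
  | a :: l => .cons a (Val.ofList l)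

/-- A point of the plane, given by its two coordinates. -/
def Val.ofPoint (p : Plane) : Val := .cons (.num (p 0)) (.num (p 1))

/-- The input: the parameter `ε`, the list of cameras, and the list of targets. -/
def encodeInput {n : ℕ} (ε : ℝ) (c : Fin (2 * n) → Plane) (t : Fin n → Plane) : Val :=
  .cons (.num ε) (.cons (Val.ofList (List.ofFn fun i => Val.ofPoint (c i)))
    (Val.ofList (List.ofFn fun k => Val.ofPoint (t k))))

/-- The output `v` describes the assignment `A`: it lists, in any order, one triple
(target, first camera, second camera) for each target. -/
def IsOutput {n : ℕ} (c : Fin (2 * n) → Plane) (t : Fin n → Plane) (A : CameraAssignment n)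
    (v : Val) : Prop :=
  ∃ L : List Val,
    L.Perm (List.ofFn fun k => Val.cons (Val.ofPoint (t k))
      (Val.cons (Val.ofPoint (c (A.fst k))) (Val.ofPoint (c (A.snd k))))) ∧
    v = Val.ofList L

/-! ## Evaluation with a bound on the number of steps -/

/-- `Ev P env e v b`: the evaluation of `e` yields `v` in at most `b` steps. -/
def Ev (P : List Expr) (env : List Val) (e : Expr) (v : Val) (b : ℕ) : Prop :=
  ∃ s, s ≤ b ∧ Eval P env e v s

namespace Ev

variable {P : List Expr} {env : List Val}

theorem mono {e : Expr} {v : Val} {s b : ℕ} (h : Ev P env e v s) (hs : s ≤ b) :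
    Ev P env e v b := by
  obtain ⟨t, ht, h⟩ := h
  exact ⟨t, ht.trans hs, h⟩

theorem var {i : ℕ} {v : Val} (h : env[i]? = some v) : Ev P env (.var i) v 1 :=
  ⟨1, le_rfl, .var h⟩

theorem const {q : ℚ} {x : ℝ} (h : (q : ℝ) = x) : Ev P env (.const q) (.num x) 1 :=
  h ▸ ⟨1, le_rfl, .const⟩

theorem nil : Ev P env .nil .nil 1 := ⟨1, le_rfl, .nil⟩

theorem cons {a b : Expr} {v w : Val} {s t : ℕ} (ha : Ev P env a v s) (hb : Ev P env b w t) :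
    Ev P env (.cons a b) (.cons v w) (s + t + 1) := by
  obtain ⟨s', hs, ha⟩ := ha
  obtain ⟨t', ht, hb⟩ := hb
  exact ⟨_, by omega, .cons ha hb⟩

theorem op {o : ArithOp} {a b : Expr} {x y : ℝ} {s t : ℕ} (ha : Ev P env a (.num x) s)
    (hb : Ev P env b (.num y) t) (h : o = .div → y ≠ 0) :
    Ev P env (.op o a b) (.num (o.eval x y)) (s + t + 1) := by
  obtain ⟨s', hs, ha⟩ := ha
  obtain ⟨t', ht, hb⟩ := hb
  exact ⟨_, by omega, .op ha hb h⟩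

theorem add {a b : Expr} {x y : ℝ} {s t : ℕ} (ha : Ev P env a (.num x) s)
    (hb : Ev P env b (.num y) t) : Ev P env (.op .add a b) (.num (x + y)) (s + t + 1) :=
  op ha hb (by simp)

theorem sub {a b : Expr} {x y : ℝ} {s t : ℕ} (ha : Ev P env a (.num x) s)
    (hb : Ev P env b (.num y) t) : Ev P env (.op .sub a b) (.num (x - y)) (s + t + 1) :=
  op ha hb (by simp)

theorem mul {a b : Expr} {x y : ℝ} {s t : ℕ} (ha : Ev P env a (.num x) s)
    (hb : Ev P env b (.num y) t) : Ev P env (.op .mul a b) (.num (x * y)) (s + t + 1) :=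
  op ha hb (by simp)

theorem div {a b : Expr} {x y : ℝ} {s t : ℕ} (ha : Ev P env a (.num x) s)
    (hb : Ev P env b (.num y) t) (h : y ≠ 0) :
    Ev P env (.op .div a b) (.num (x / y)) (s + t + 1) :=
  op ha hb fun _ => h

theorem ifLE_true {a b d e : Expr} {x y : ℝ} {v : Val} {s t r : ℕ}
    (ha : Ev P env a (.num x) s) (hb : Ev P env b (.num y) t) (h : x ≤ y)
    (hd : Ev P env d v r) : Ev P env (.ifLE a b d e) v (s + t + r + 1) := by
  obtain ⟨s', hs, ha⟩ := ha
  obtain ⟨t', ht, hb⟩ := hb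
  obtain ⟨r', hr, hd⟩ := hd
  exact ⟨_, by omega, .ifLE_true ha hb h hd⟩

theorem ifLE_false {a b d e : Expr} {x y : ℝ} {v : Val} {s t r : ℕ}
    (ha : Ev P env a (.num x) s) (hb : Ev P env b (.num y) t) (h : y < x)
    (he : Ev P env e v r) : Ev P env (.ifLE a b d e) v (s + t + r + 1) := by
  obtain ⟨s', hs, ha⟩ := ha
  obtain ⟨t', ht, hb⟩ := hb
  obtain ⟨r', hr, he⟩ := he
  exact ⟨_, by omega, .ifLE_false ha hb h he⟩

theorem split_cons {a d e : Expr} {x y v : Val} {s t : ℕ} (ha : Ev P env a (.cons x y) s)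
    (hd : Ev P (x :: y :: env) d v t) : Ev P env (.split a d e) v (s + t + 1) := by
  obtain ⟨s', hs, ha⟩ := ha
  obtain ⟨t', ht, hd⟩ := hd
  exact ⟨_, by omega, .split_cons ha hd⟩

theorem split_nil {a d e : Expr} {v : Val} {s t : ℕ} (ha : Ev P env a .nil s)
    (he : Ev P env e v t) : Ev P env (.split a d e) v (s + t + 1) := by
  obtain ⟨s', hs, ha⟩ := ha
  obtain ⟨t', ht, he⟩ := he
  exact ⟨_, by omega, .split_nil ha he⟩

theorem bind {a d : Expr} {x v : Val} {s t : ℕ} (ha : Ev P env a x s)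
    (hd : Ev P (x :: env) d v t) : Ev P env (.bind a d) v (s + t + 1) := by
  obtain ⟨s', hs, ha⟩ := ha
  obtain ⟨t', ht, hd⟩ := hd
  exact ⟨_, by omega, .bind ha hd⟩

theorem call {f : ℕ} {a body : Expr} {x v : Val} {s t : ℕ} (ha : Ev P env a x s)
    (hf : P[f]? = some body) (hb : Ev P [x] body v t) :
    Ev P env (.call f a) v (s + t + 1) := by
  obtain ⟨s', hs, ha⟩ := ha
  obtain ⟨t', ht, hb⟩ := hb
  exact ⟨_, by omega, .call ha hf hb⟩

end Ev

/-! ## The program -/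

namespace CameraProgram

/-- `(e, l) ↦` the insertion of the keyed element `e` into the descending list `l`. -/
def insertBody : Expr :=
  .split (.var 0) (.split (.var 1) (.split (.var 0) (.split (.var 4)
    (.ifLE (.var 2) (.var 0) (.cons (.var 6) (.var 7))
      (.cons (.var 4) (.call 0 (.cons (.var 6) (.var 5))))) .nil) .nil)
    (.cons (.var 0) .nil)) .nil

/-- `(w, l) ↦` the points of `l`, sorted by their inner product with `w`. -/
def sortCamerasBody : Expr :=
  .split (.var 0) (.split (.var 1) (.split (.var 0) (.split (.var 4)
    (.call 0 (.cons (.cons (.op .add (.op .mul (.var 2) (.var 0)) (.op .mul (.var 3) (.var 1)))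
      (.var 4)) (.call 1 (.cons (.var 6) (.var 5))))) .nil) .nil) .nil) .nil

/-- `((w, c), l) ↦` the points `p` of `l`, sorted by the area spanned by `p - c` and `w`. -/
def sortTargetsBody : Expr :=
  .split (.var 0) (.split (.var 1) (.split (.var 0) (.split (.var 4) (.split (.var 0)
    (.split (.var 3) (.bind (.op .sub (.op .mul (.op .sub (.var 6) (.var 0)) (.var 3))
        (.op .mul (.op .sub (.var 7) (.var 1)) (.var 2)))
      (.call 0 (.cons (.cons (.ifLE (.var 0) (.const 0) (.op .sub (.const 0) (.var 0)) (.var 0))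
        (.var 9)) (.call 2 (.cons (.var 11) (.var 10)))))) .nil) .nil) .nil) .nil) .nil) .nil

/-- `(k, l, acc) ↦ (first k elements of l, reversed, in front of acc; remaining elements of l)`,
where the number `k` is given as a list. -/
def halveBody : Expr :=
  .split (.var 0) (.split (.var 1) (.split (.var 2) (.split (.var 2)
    (.call 3 (.cons (.var 3) (.cons (.var 1) (.cons (.var 0) (.var 5))))) .nil)
    (.cons (.var 1) (.var 0))) .nil) .nil

/-- `((m, lam), r, l, acc) ↦` the reversal of `l`, in front of `acc`, with each key `s` replaced by
`|s - m|`, rounded down to a cluster leader; `r` is the current leader. -/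
def roundBody : Expr :=
  .split (.var 0) (.split (.var 0) (.split (.var 3) (.split (.var 1) (.split (.var 0)
    (.split (.var 0)
      (.bind (.ifLE (.var 0) (.var 8) (.op .sub (.var 8) (.var 0)) (.op .sub (.var 0) (.var 8)))
        (.ifLE (.var 0) (.op .mul (.var 10) (.var 7))
          (.call 4 (.cons (.var 11) (.cons (.var 7) (.cons (.var 4)
            (.cons (.cons (.var 7) (.var 2)) (.var 6))))))
          (.call 4 (.cons (.var 11) (.cons (.var 0) (.cons (.var 4)
            (.cons (.cons (.var 0) (.var 2)) (.var 6)))))))) .nil)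
    (.var 1)) .nil) .nil) .nil) .nil

/-- `(x, ps) ↦` the pairs `(y, x :: l)`, for `(y, l)` in `ps`. -/
def mapConsBody : Expr :=
  .split (.var 0) (.split (.var 1) (.split (.var 0)
    (.cons (.cons (.var 0) (.cons (.var 4) (.var 1))) (.call 5 (.cons (.var 4) (.var 3)))) .nil)
    .nil) .nil

/-- `(tau, l) ↦` the pairs `(x, l without x)`, where `x` is last in `l` or at least `tau`. -/
def picksBody : Expr :=
  .split (.var 0) (.split (.var 1) (.split (.var 1) (.split (.var 2)
    (.bind (.call 5 (.cons (.var 4) (.call 6 (.cons (.var 6) (.var 5)))))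
      (.ifLE (.var 7) (.var 1) (.cons (.cons (.var 5) (.var 6)) (.var 0)) (.var 0))) .nil)
    (.cons (.cons (.var 0) .nil) .nil)) .nil) .nil

/-- The value is `0` if the keys in the two lists agree, and `1` otherwise. -/
def eqKeysBody : Expr :=
  .split (.var 0) (.split (.var 0) (.split (.var 3) (.split (.var 0) (.split (.var 4)
    (.ifLE (.var 0) (.var 2) (.ifLE (.var 2) (.var 0) (.call 7 (.cons (.var 7) (.var 5)))
      (.const 1)) (.const 1)) .nil) .nil) (.const 1)) (.split (.var 1) (.const 1) (.const 0))) .nil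

/-- `(st, acc) ↦` the insertion of the state `st` into `acc`, where only the cheaper of two states
with the same keys is kept. -/
def insStateBody : Expr :=
  .split (.var 0) (.split (.var 1) (.split (.var 0) (.split (.var 1) (.split (.var 1)
    (.split (.var 8) (.split (.var 1) (.split (.var 1)
      (.ifLE (.op .add (.call 7 (.cons (.var 2) (.var 8))) (.call 7 (.cons (.var 0) (.var 6))))
        (.const 0)
        (.ifLE (.var 4) (.var 10) (.cons (.var 14) (.var 13)) (.var 15))
        (.cons (.var 12) (.call 8 (.cons (.var 14) (.var 13)))))
      .nil) .nil) .nil) .nil) .nil) .nil) (.cons (.var 0) .nil)) .nil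

/-- `((zt, pa, cost, out), pbs, acc) ↦` the insertion into `acc` of the successors of a state in
which the choice `pa` is made in the first list, and a choice in `pbs` in the second list. -/
def combineBody : Expr :=
  .split (.var 0) (.split (.var 1) (.split (.var 0) (.split (.var 0) (.split (.var 0)
    (.split (.var 8) (.split (.var 0) (.split (.var 3) (.split (.var 0) (.split (.var 0)
      (.split (.var 5)
        (.call 8 (.cons
          (.cons (.op .add (.var 0) (.op .div (.var 8) (.op .add (.var 2) (.var 12))))
            (.cons (.var 5) (.cons (.var 15)
              (.cons (.cons (.var 9) (.cons (.var 3) (.var 13))) (.var 1)))))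
          (.call 9 (.cons (.var 20) (.cons (.var 17) (.var 19))))))
      .nil) .nil) .nil) .nil) .nil) .nil) .nil) .nil) (.var 1)) .nil) .nil

/-- `(zt, pas, pbs, (cost, out), acc) ↦` the insertion into `acc` of the successors of a state in
which the choices are in `pas` and `pbs`. -/
def combineAllBody : Expr :=
  .split (.var 0) (.split (.var 1) (.split (.var 1) (.split (.var 1) (.split (.var 4)
    (.call 9 (.cons (.cons (.var 8) (.cons (.var 0) (.var 2))) (.cons (.var 4)
      (.call 10 (.cons (.var 8) (.cons (.var 1) (.cons (.var 4) (.cons (.var 2) (.var 3)))))))))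
    (.var 1)) .nil) .nil) .nil) .nil

/-- `(kappa, zt, sts) ↦` the successors of the states in `sts`. -/
def expandBody : Expr :=
  .split (.var 0) (.split (.var 1) (.split (.var 1) (.split (.var 0) (.split (.var 1)
    (.split (.var 1) (.split (.var 2) (.split (.var 0) (.split (.var 4) (.split (.var 0)
      (.bind (.op .mul (.var 18) (.op .add (.var 4) (.var 0)))
        (.call 10 (.cons (.var 17) (.cons (.call 6 (.cons (.var 0) (.var 11)))
          (.cons (.call 6 (.cons (.var 0) (.var 9))) (.cons (.cons (.var 13) (.var 10))
            (.call 11 (.cons (.var 19) (.cons (.var 17) (.var 16))))))))))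
      .nil) (.call 11 (.cons (.var 14) (.cons (.var 12) (.var 11))))) .nil)
      (.call 11 (.cons (.var 10) (.cons (.var 8) (.var 7)))))
    .nil) .nil) .nil) .nil) .nil) .nil

/-- `(kappa, zts, sts) ↦` the states that are reached from `sts` by serving the targets `zts`. -/
def loopBody : Expr :=
  .split (.var 0) (.split (.var 1) (.split (.var 0)
    (.call 12 (.cons (.var 4) (.cons (.var 1) (.call 11 (.cons (.var 4) (.cons (.var 0)
      (.var 3))))))) (.var 1)) .nil) .nil

/-- The procedures of the program. -/
def procs : List Expr :=
  [insertBody, sortCamerasBody, sortTargetsBody, halveBody, roundBody, mapConsBody, picksBody,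
    eqKeysBody, insStateBody, combineBody, combineAllBody, expandBody, loopBody]

/-- The main expression of the program. -/
def mainExpr : Expr :=
  .split (.var 0) (.split (.var 1) (.split (.var 0) (.split (.var 1) (.split (.var 2)
    (.split (.var 2)
      (.bind (.cons (.op .sub (.var 0) (.var 2)) (.op .sub (.var 1) (.var 3)))
      (.bind (.call 2 (.cons (.cons (.var 0) (.var 7)) (.var 10)))
      (.bind (.call 3 (.cons (.var 11) (.cons (.call 1 (.cons (.var 1) (.var 10))) .nil)))
      (.split (.var 0) (.split (.var 0) (.split (.var 0)
        (.bind (.cons (.var 0) (.op .add (.const 1) (.op .div (.var 19) (.const 4))))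
        (.bind (.call 12 (.cons (.op .div (.var 20) (.const 16)) (.cons (.var 8) (.cons
          (.cons (.const 0) (.cons
            (.call 4 (.cons (.var 0) (.cons (.const 0) (.cons (.var 5) .nil))))
            (.cons (.call 4 (.cons (.var 0) (.cons (.const 0) (.cons (.var 6) .nil)))) .nil)))
          .nil))))
        (.split (.var 0) (.split (.var 0) (.split (.var 1) (.split (.var 1) (.var 1)
          .nil) .nil) .nil) .nil)))
      .nil) .nil) .nil)))) .nil) .nil) .nil) .nil) .nil) .nil

/-- The approximation scheme. -/
def program : Program := ⟨procs, mainExpr⟩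

/-! ## The functions computed by the procedures -/

variable {α β : Type*}

/-- The code of an element with a key. -/
def encElem (ea : α → Val) (e : ℝ × α) : Val := .cons (.num e.1) (ea e.2)

/-- The code of a list of elements with keys. -/
def encList (ea : α → Val) (l : List (ℝ × α)) : Val := Val.ofList (l.map (encElem ea))

/-- The code of a list of choices. -/
def encPicks (ea : α → Val) (l : List ((ℝ × α) × List (ℝ × α))) : Val :=
  Val.ofList (l.map fun p => .cons (encElem ea p.1) (encList ea p.2))

/-- The comparison of elements by their keys, in descending order. -/
def KeyGE (x y : ℝ × α) : Prop := y.1 ≤ x.1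

noncomputable instance : DecidableRel (KeyGE (α := α)) := fun _ _ => Classical.dec _

instance : Std.Total (KeyGE (α := α)) := ⟨fun x y => le_total y.1 x.1⟩

instance : IsTrans (ℝ × α) KeyGE := ⟨fun _ _ _ h1 h2 => le_trans (α := ℝ) h2 h1⟩

theorem insert_ev (ea : α → Val) (e : ℝ × α) (l : List (ℝ × α)) :
    Ev procs [.cons (encElem ea e) (encList ea l)] insertBody
      (encList ea (l.orderedInsert KeyGE e)) (20 * (l.length + 1)) := by
  induction l with
  | nil =>
    apply Ev.mono
    · exact Ev.split_cons (Ev.var rfl) (Ev.split_nil (Ev.var rfl) (Ev.cons (Ev.var rfl) Ev.nil))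
    · norm_num
  | cons h t ih =>
    rw [List.orderedInsert]
    split_ifs with hc
    · apply Ev.mono
      · exact Ev.split_cons (Ev.var rfl) (Ev.split_cons (Ev.var rfl) (Ev.split_cons (Ev.var rfl)
          (Ev.split_cons (Ev.var rfl) (Ev.ifLE_true (Ev.var rfl) (Ev.var rfl) hc
          (Ev.cons (Ev.var rfl) (Ev.var rfl))))))
      · simp only [List.length_cons]; omega
    · apply Ev.mono
      · exact Ev.split_cons (Ev.var rfl) (Ev.split_cons (Ev.var rfl) (Ev.split_cons (Ev.var rfl)
          (Ev.split_cons (Ev.var rfl) (Ev.ifLE_false (Ev.var rfl) (Ev.var rfl) (lt_of_not_ge hc)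
          (Ev.cons (Ev.var rfl) (Ev.call (Ev.cons (Ev.var rfl) (Ev.var rfl)) rfl ih))))))
      · simp only [List.length_cons]; omega

/-- The inner product of a point with the vector `(w₀, w₁)`. -/
noncomputable def dotKey (w₀ w₁ : ℝ) (p : Plane) : ℝ := p 0 * w₀ + p 1 * w₁

/-- The area spanned by the vectors from `c` to `p` and `(w₀, w₁)`. -/
noncomputable def areaKey (w₀ w₁ : ℝ) (c p : Plane) : ℝ :=
  |(p 0 - c 0) * w₁ - (p 1 - c 1) * w₀|

theorem sortCameras_ev (w₀ w₁ : ℝ) (c : α → Plane) (l : List α) :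
    Ev procs [.cons (.cons (.num w₀) (.num w₁)) (Val.ofList (l.map fun i => Val.ofPoint (c i)))]
      sortCamerasBody
      (encList (fun i => Val.ofPoint (c i))
        ((l.map fun i => (dotKey w₀ w₁ (c i), i)).insertionSort KeyGE))
      (60 * (l.length + 1) ^ 2) := by
  induction l with
  | nil =>
    apply Ev.mono
    · exact Ev.split_cons (Ev.var rfl) (Ev.split_nil (Ev.var rfl) Ev.nil)
    · norm_num
  | cons i l ih =>
    apply Ev.mono
    · exact Ev.split_cons (Ev.var rfl) (Ev.split_cons (Ev.var rfl) (Ev.split_cons (Ev.var rfl)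
        (Ev.split_cons (Ev.var rfl) (Ev.call (Ev.cons (Ev.cons (Ev.add
          (Ev.mul (Ev.var rfl) (Ev.var rfl)) (Ev.mul (Ev.var rfl) (Ev.var rfl))) (Ev.var rfl))
          (Ev.call (Ev.cons (Ev.var rfl) (Ev.var rfl)) rfl ih)) rfl
          (insert_ev (fun i => Val.ofPoint (c i)) (dotKey w₀ w₁ (c i), i) _)))))
    · simp only [List.length_insertionSort, List.length_map, List.length_cons]
      nlinarith

theorem sortTargets_ev (w₀ w₁ : ℝ) (c : Plane) (t : β → Plane) (l : List β) :
    Ev procs [.cons (.cons (.cons (.num w₀) (.num w₁)) (Val.ofPoint c))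
        (Val.ofList (l.map fun i => Val.ofPoint (t i)))] sortTargetsBody
      (encList (fun i => Val.ofPoint (t i))
        ((l.map fun i => (areaKey w₀ w₁ c (t i), i)).insertionSort KeyGE))
      (100 * (l.length + 1) ^ 2) := by
  induction l with
  | nil =>
    apply Ev.mono
    · exact Ev.split_cons (Ev.var rfl) (Ev.split_nil (Ev.var rfl) Ev.nil)
    · norm_num
  | cons i l ih =>
    have key : Ev procs
        ((.num ((t i 0 - c 0) * w₁ - (t i 1 - c 1) * w₀)) :: [.num (c 0), .num (c 1), .num w₀,
          .num w₁, .cons (.num w₀) (.num w₁), Val.ofPoint c, .num (t i 0), .num (t i 1),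
          Val.ofPoint (t i), Val.ofList (l.map fun i => Val.ofPoint (t i)),
          .cons (.cons (.num w₀) (.num w₁)) (Val.ofPoint c),
          Val.ofList ((i :: l).map fun i => Val.ofPoint (t i)),
          .cons (.cons (.cons (.num w₀) (.num w₁)) (Val.ofPoint c))
            (Val.ofList ((i :: l).map fun i => Val.ofPoint (t i)))])
        (.ifLE (.var 0) (.const 0) (.op .sub (.const 0) (.var 0)) (.var 0))
        (.num (areaKey w₀ w₁ c (t i))) 6 := by
      rcases le_or_gt ((t i 0 - c 0) * w₁ - (t i 1 - c 1) * w₀) 0 with h | h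
      · rw [areaKey, abs_of_nonpos h, ← zero_sub]
        exact Ev.ifLE_true (Ev.var rfl) (Ev.const (by simp)) h
          (Ev.sub (Ev.const (by simp)) (Ev.var rfl))
      · rw [areaKey, abs_of_pos h]
        exact (Ev.ifLE_false (Ev.var rfl) (Ev.const (by simp)) h (Ev.var rfl)).mono (by norm_num)
    apply Ev.mono
    · exact Ev.split_cons (Ev.var rfl) (Ev.split_cons (Ev.var rfl) (Ev.split_cons (Ev.var rfl)
        (Ev.split_cons (Ev.var rfl) (Ev.split_cons (Ev.var rfl) (Ev.split_cons (Ev.var rfl)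
        (Ev.bind (Ev.sub (Ev.mul (Ev.sub (Ev.var rfl) (Ev.var rfl)) (Ev.var rfl))
          (Ev.mul (Ev.sub (Ev.var rfl) (Ev.var rfl)) (Ev.var rfl)))
        (Ev.call (Ev.cons (Ev.cons key (Ev.var rfl))
          (Ev.call (Ev.cons (Ev.var rfl) (Ev.var rfl)) rfl ih)) rfl
          (insert_ev (fun i => Val.ofPoint (t i)) (areaKey w₀ w₁ c (t i), i) _))))))))
    · simp only [List.length_insertionSort, List.length_map, List.length_cons]
      nlinarith

theorem halve_ev (ea : α → Val) (ts : List Val) (l acc : List (ℝ × α))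
    (h : ts.length ≤ l.length) :
    Ev procs [.cons (Val.ofList ts) (.cons (encList ea l) (encList ea acc))] halveBody
      (.cons (encList ea ((l.take ts.length).reverse ++ acc)) (encList ea (l.drop ts.length)))
      (30 * (ts.length + 1)) := by
  induction ts generalizing l acc with
  | nil =>
    apply Ev.mono
    · exact Ev.split_cons (Ev.var rfl) (Ev.split_cons (Ev.var rfl) (Ev.split_nil (Ev.var rfl)
        (Ev.cons (Ev.var rfl) (Ev.var rfl))))
    · norm_num
  | cons a ts ih =>
    obtain _ | ⟨x, l⟩ := l
    · simp at h
    · have := ih l (x :: acc) (by simpa using h)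
      rw [List.length_cons, List.take_succ_cons, List.drop_succ_cons, List.reverse_cons,
        List.append_assoc, List.singleton_append]
      apply Ev.mono
      · exact Ev.split_cons (Ev.var rfl) (Ev.split_cons (Ev.var rfl) (Ev.split_cons (Ev.var rfl)
          (Ev.split_cons (Ev.var rfl) (Ev.call (Ev.cons (Ev.var rfl) (Ev.cons (Ev.var rfl)
            (Ev.cons (Ev.var rfl) (Ev.var rfl)))) rfl this))))
      · omega

/-- The reversal of a list, in front of `acc`, with keys replaced by their rounded distances
to `m`; the current leader is `r`. -/
noncomputable def roundList (m lam : ℝ) : ℝ → List (ℝ × α) → List (ℝ × α) → List (ℝ × α)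
  | _, [], acc => acc
  | r, e :: l, acc =>
    if |e.1 - m| ≤ lam * r then roundList m lam r l ((r, e.2) :: acc)
    else roundList m lam |e.1 - m| l ((|e.1 - m|, e.2) :: acc)

theorem round_ev (ea : α → Val) (m lam r : ℝ) (l acc : List (ℝ × α)) :
    Ev procs [.cons (.cons (.num m) (.num lam)) (.cons (.num r)
        (.cons (encList ea l) (encList ea acc)))] roundBody
      (encList ea (roundList m lam r l acc)) (60 * (l.length + 1)) := by
  induction l generalizing r acc with
  | nil =>
    apply Ev.mono
    · exact Ev.split_cons (Ev.var rfl) (Ev.split_cons (Ev.var rfl) (Ev.split_cons (Ev.var rfl)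
        (Ev.split_cons (Ev.var rfl) (Ev.split_nil (Ev.var rfl) (Ev.var rfl)))))
    · norm_num
  | cons e l ih =>
    have key : Ev procs [.num e.1, ea e.2, encElem ea e, encList ea l, encList ea (e :: l),
          encList ea acc, .num r, .cons (encList ea (e :: l)) (encList ea acc), .num m, .num lam,
          .cons (.num m) (.num lam),
          .cons (.num r) (.cons (encList ea (e :: l)) (encList ea acc)),
          .cons (.cons (.num m) (.num lam)) (.cons (.num r)
            (.cons (encList ea (e :: l)) (encList ea acc)))]
        (.ifLE (.var 0) (.var 8) (.op .sub (.var 8) (.var 0)) (.op .sub (.var 0) (.var 8)))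
        (.num |e.1 - m|) 6 := by
      rcases le_or_gt e.1 m with h | h
      · rw [abs_sub_comm, abs_of_nonneg (by linarith)]
        exact Ev.ifLE_true (Ev.var rfl) (Ev.var rfl) h (Ev.sub (Ev.var rfl) (Ev.var rfl))
      · rw [abs_of_pos (by linarith)]
        exact Ev.ifLE_false (Ev.var rfl) (Ev.var rfl) h (Ev.sub (Ev.var rfl) (Ev.var rfl))
    rw [roundList]
    split_ifs with hc
    · apply Ev.mono
      · exact Ev.split_cons (Ev.var rfl) (Ev.split_cons (Ev.var rfl) (Ev.split_cons (Ev.var rfl)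
          (Ev.split_cons (Ev.var rfl) (Ev.split_cons (Ev.var rfl) (Ev.split_cons (Ev.var rfl)
          (Ev.bind key (Ev.ifLE_true (Ev.var rfl) (Ev.mul (Ev.var rfl) (Ev.var rfl)) hc
          (Ev.call (Ev.cons (Ev.var rfl) (Ev.cons (Ev.var rfl) (Ev.cons (Ev.var rfl)
            (Ev.cons (Ev.cons (Ev.var rfl) (Ev.var rfl)) (Ev.var rfl))))) rfl
            (ih r ((r, e.2) :: acc))))))))))
      · simp only [List.length_cons]; omega
    · apply Ev.mono
      · exact Ev.split_cons (Ev.var rfl) (Ev.split_cons (Ev.var rfl) (Ev.split_cons (Ev.var rfl)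
          (Ev.split_cons (Ev.var rfl) (Ev.split_cons (Ev.var rfl) (Ev.split_cons (Ev.var rfl)
          (Ev.bind key (Ev.ifLE_false (Ev.var rfl) (Ev.mul (Ev.var rfl) (Ev.var rfl))
            (lt_of_not_ge hc)
          (Ev.call (Ev.cons (Ev.var rfl) (Ev.cons (Ev.var rfl) (Ev.cons (Ev.var rfl)
            (Ev.cons (Ev.cons (Ev.var rfl) (Ev.var rfl)) (Ev.var rfl))))) rfl
            (ih |e.1 - m| ((|e.1 - m|, e.2) :: acc))))))))))
      · simp only [List.length_cons]; omega

theorem mapCons_ev (ea : α → Val) (x : ℝ × α) (ps : List ((ℝ × α) × List (ℝ × α))) :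
    Ev procs [.cons (encElem ea x) (encPicks ea ps)] mapConsBody
      (encPicks ea (ps.map fun p => (p.1, x :: p.2))) (20 * (ps.length + 1)) := by
  induction ps with
  | nil =>
    apply Ev.mono
    · exact Ev.split_cons (Ev.var rfl) (Ev.split_nil (Ev.var rfl) Ev.nil)
    · norm_num
  | cons p ps ih =>
    apply Ev.mono
    · exact Ev.split_cons (Ev.var rfl) (Ev.split_cons (Ev.var rfl) (Ev.split_cons (Ev.var rfl)
        (Ev.cons (Ev.cons (Ev.var rfl) (Ev.cons (Ev.var rfl) (Ev.var rfl)))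
          (Ev.call (Ev.cons (Ev.var rfl) (Ev.var rfl)) rfl ih))))
    · simp only [List.length_cons]; omega

/-- The choices of an element that is last in the list or has key at least `tau`, together with
the remaining list. -/
noncomputable def picks (tau : ℝ) : List (ℝ × α) → List ((ℝ × α) × List (ℝ × α))
  | [] => []
  | [x] => [(x, [])]
  | x :: y :: l =>
    if tau ≤ x.1 then (x, y :: l) :: (picks tau (y :: l)).map fun p => (p.1, x :: p.2)
    else (picks tau (y :: l)).map fun p => (p.1, x :: p.2)

theorem length_picks_le (tau : ℝ) (l : List (ℝ × α)) : (picks tau l).length ≤ l.length := by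
  fun_induction picks tau l <;> simp_all
  omega

theorem picks_ev (ea : α → Val) (tau : ℝ) (l : List (ℝ × α)) :
    Ev procs [.cons (.num tau) (encList ea l)] picksBody (encPicks ea (picks tau l))
      (30 * (l.length + 1) ^ 2) := by
  fun_induction picks tau l with
  | case1 =>
    apply Ev.mono
    · exact Ev.split_cons (Ev.var rfl) (Ev.split_nil (Ev.var rfl) Ev.nil)
    · norm_num
  | case2 x =>
    apply Ev.mono
    · exact Ev.split_cons (Ev.var rfl) (Ev.split_cons (Ev.var rfl) (Ev.split_nil (Ev.var rfl)
        (Ev.cons (Ev.cons (Ev.var rfl) Ev.nil) Ev.nil)))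
    · norm_num
  | case3 x y l hc ih =>
    have hl := length_picks_le tau (y :: l)
    apply Ev.mono
    · exact Ev.split_cons (Ev.var rfl) (Ev.split_cons (Ev.var rfl) (Ev.split_cons (Ev.var rfl)
        (Ev.split_cons (Ev.var rfl) (Ev.bind (Ev.call (Ev.cons (Ev.var rfl) (Ev.call
          (Ev.cons (Ev.var rfl) (Ev.var rfl)) rfl ih)) rfl (mapCons_ev ea x _))
        (Ev.ifLE_true (Ev.var rfl) (Ev.var rfl) hc
          (Ev.cons (Ev.cons (Ev.var rfl) (Ev.var rfl)) (Ev.var rfl)))))))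
    · simp only [List.length_cons] at hl ⊢; nlinarith
  | case4 x y l hc ih =>
    have hl := length_picks_le tau (y :: l)
    apply Ev.mono
    · exact Ev.split_cons (Ev.var rfl) (Ev.split_cons (Ev.var rfl) (Ev.split_cons (Ev.var rfl)
        (Ev.split_cons (Ev.var rfl) (Ev.bind (Ev.call (Ev.cons (Ev.var rfl) (Ev.call
          (Ev.cons (Ev.var rfl) (Ev.var rfl)) rfl ih)) rfl (mapCons_ev ea x _))
        (Ev.ifLE_false (Ev.var rfl) (Ev.var rfl) (lt_of_not_ge hc) (Ev.var rfl))))))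
    · simp only [List.length_cons] at hl ⊢; nlinarith

theorem eqKeys_ev (ea : α → Val) (l l' : List (ℝ × α)) :
    ∃ x : ℝ, 0 ≤ x ∧ (x ≤ 0 ↔ l.map Prod.fst = l'.map Prod.fst) ∧
      Ev procs [.cons (encList ea l) (encList ea l')] eqKeysBody (.num x)
        (30 * (l.length + 1)) := by
  induction l generalizing l' with
  | nil =>
    cases l' with
    | nil =>
      refine ⟨0, le_rfl, by simp, ?_⟩
      apply Ev.mono
      · exact Ev.split_cons (Ev.var rfl) (Ev.split_nil (Ev.var rfl) (Ev.split_nil (Ev.var rfl)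
          (Ev.const (by simp))))
      · norm_num
    | cons y l' =>
      refine ⟨1, zero_le_one, by simp, ?_⟩
      apply Ev.mono
      · exact Ev.split_cons (Ev.var rfl) (Ev.split_nil (Ev.var rfl) (Ev.split_cons (Ev.var rfl)
          (Ev.const (by simp))))
      · norm_num
  | cons x l ih =>
    cases l' with
    | nil =>
      refine ⟨1, zero_le_one, by simp, ?_⟩
      apply Ev.mono
      · exact Ev.split_cons (Ev.var rfl) (Ev.split_cons (Ev.var rfl) (Ev.split_nil (Ev.var rfl)
          (Ev.const (by simp))))
      · simp only [List.length_cons]; omega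
    | cons y l' =>
      rcases lt_trichotomy y.1 x.1 with h | h | h
      · refine ⟨1, zero_le_one, by simp [h.ne'], ?_⟩
        apply Ev.mono
        · exact Ev.split_cons (Ev.var rfl) (Ev.split_cons (Ev.var rfl) (Ev.split_cons (Ev.var rfl)
            (Ev.split_cons (Ev.var rfl) (Ev.split_cons (Ev.var rfl) (Ev.ifLE_false (Ev.var rfl)
            (Ev.var rfl) h (Ev.const (by simp)))))))
        · simp only [List.length_cons]; omega
      · obtain ⟨b, hb, hiff, hev⟩ := ih l'
        refine ⟨b, hb, by simp [hiff, h], ?_⟩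
        apply Ev.mono
        · exact Ev.split_cons (Ev.var rfl) (Ev.split_cons (Ev.var rfl) (Ev.split_cons (Ev.var rfl)
            (Ev.split_cons (Ev.var rfl) (Ev.split_cons (Ev.var rfl) (Ev.ifLE_true (Ev.var rfl)
            (Ev.var rfl) h.ge (Ev.ifLE_true (Ev.var rfl) (Ev.var rfl) h.le
            (Ev.call (Ev.cons (Ev.var rfl) (Ev.var rfl)) rfl hev)))))))
        · simp only [List.length_cons]; omega
      · refine ⟨1, zero_le_one, by simp [h.ne], ?_⟩
        apply Ev.mono
        · exact Ev.split_cons (Ev.var rfl) (Ev.split_cons (Ev.var rfl) (Ev.split_cons (Ev.var rfl)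
            (Ev.split_cons (Ev.var rfl) (Ev.split_cons (Ev.var rfl) (Ev.ifLE_true (Ev.var rfl)
            (Ev.var rfl) h.le (Ev.ifLE_false (Ev.var rfl) (Ev.var rfl) h
            (Ev.const (by simp))))))))
        · simp only [List.length_cons]; omega

/-- A state of the search: the cost and the list of the triples chosen so far, and the lists of
the elements that remain on the two sides, with their keys. -/
structure SearchState (α β : Type*) where
  cost : ℝ
  left : List (ℝ × α)
  right : List (ℝ × α)
  out : List (β × α × α)

/-- The keys that remain on the two sides. -/
def SearchState.keys (st : SearchState α β) : List ℝ × List ℝ :=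
  (st.left.map Prod.fst, st.right.map Prod.fst)

/-- The code of a list of triples. -/
def encOut (ea : α → Val) (eb : β → Val) (l : List (β × α × α)) : Val :=
  Val.ofList (l.map fun x => .cons (eb x.1) (.cons (ea x.2.1) (ea x.2.2)))

/-- The code of a state. -/
def encState (ea : α → Val) (eb : β → Val) (st : SearchState α β) : Val :=
  .cons (.num st.cost) (.cons (encList ea st.left) (.cons (encList ea st.right)
    (encOut ea eb st.out)))

/-- The code of a list of states. -/
def encStates (ea : α → Val) (eb : β → Val) (sts : List (SearchState α β)) : Val :=
  Val.ofList (sts.map (encState ea eb))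

open Classical in
/-- The insertion of a state into a list of states, where only the cheaper of two states with the
same keys is kept. -/
noncomputable def insertState (st : SearchState α β) :
    List (SearchState α β) → List (SearchState α β)
  | [] => [st]
  | h :: t =>
    if st.keys = h.keys then (if st.cost ≤ h.cost then st :: t else h :: t)
    else h :: insertState st t

theorem length_insertState_le (st : SearchState α β) (acc : List (SearchState α β)) :
    (insertState st acc).length ≤ acc.length + 1 := by
  fun_induction insertState st acc <;> simp_all

theorem insertState_ev (ea : α → Val) (eb : β → Val) (st : SearchState α β)
    (acc : List (SearchState α β)) {n : ℕ} (h1 : st.left.length ≤ n) (h2 : st.right.length ≤ n) :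
    Ev procs [.cons (encState ea eb st) (encStates ea eb acc)] insStateBody
      (encStates ea eb (insertState st acc)) (120 * (n + 1) * (acc.length + 1)) := by
  induction acc with
  | nil =>
    apply Ev.mono
    · exact Ev.split_cons (Ev.var rfl) (Ev.split_nil (Ev.var rfl) (Ev.cons (Ev.var rfl) Ev.nil))
    · simp only [List.length_nil]; omega
  | cons h t ih =>
    obtain ⟨x, hx0, hx, hxe⟩ := eqKeys_ev ea st.left h.left
    obtain ⟨y, hy0, hy, hye⟩ := eqKeys_ev ea st.right h.right
    have hkeys : x + y ≤ 0 ↔ st.keys = h.keys := by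
      rw [SearchState.keys, SearchState.keys, Prod.mk.injEq, ← hx, ← hy]
      constructor
      · intro h; constructor <;> linarith
      · rintro ⟨h, h'⟩; linarith
    rw [insertState]
    have hlen : 120 * (n + 1) * ((h :: t).length + 1) =
        120 * (n + 1) * (t.length + 1) + 120 * (n + 1) := by
      rw [List.length_cons]; ring
    rw [hlen]
    split_ifs with hc hd
    · apply Ev.mono
      · exact Ev.split_cons (Ev.var rfl) (Ev.split_cons (Ev.var rfl) (Ev.split_cons (Ev.var rfl)
          (Ev.split_cons (Ev.var rfl) (Ev.split_cons (Ev.var rfl) (Ev.split_cons (Ev.var rfl)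
          (Ev.split_cons (Ev.var rfl) (Ev.split_cons (Ev.var rfl)
          (Ev.ifLE_true (Ev.add (Ev.call (Ev.cons (Ev.var rfl) (Ev.var rfl)) rfl hxe)
            (Ev.call (Ev.cons (Ev.var rfl) (Ev.var rfl)) rfl hye)) (Ev.const Rat.cast_zero)
            (hkeys.2 hc) (Ev.ifLE_true (Ev.var rfl) (Ev.var rfl) hd
              (Ev.cons (Ev.var rfl) (Ev.var rfl)))))))))))
      · omega
    · apply Ev.mono
      · exact Ev.split_cons (Ev.var rfl) (Ev.split_cons (Ev.var rfl) (Ev.split_cons (Ev.var rfl)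
          (Ev.split_cons (Ev.var rfl) (Ev.split_cons (Ev.var rfl) (Ev.split_cons (Ev.var rfl)
          (Ev.split_cons (Ev.var rfl) (Ev.split_cons (Ev.var rfl)
          (Ev.ifLE_true (Ev.add (Ev.call (Ev.cons (Ev.var rfl) (Ev.var rfl)) rfl hxe)
            (Ev.call (Ev.cons (Ev.var rfl) (Ev.var rfl)) rfl hye)) (Ev.const Rat.cast_zero)
            (hkeys.2 hc) (Ev.ifLE_false (Ev.var rfl) (Ev.var rfl) (lt_of_not_ge hd)
              (Ev.var rfl))))))))))
      · omega
    · apply Ev.mono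
      · exact Ev.split_cons (Ev.var rfl) (Ev.split_cons (Ev.var rfl) (Ev.split_cons (Ev.var rfl)
          (Ev.split_cons (Ev.var rfl) (Ev.split_cons (Ev.var rfl) (Ev.split_cons (Ev.var rfl)
          (Ev.split_cons (Ev.var rfl) (Ev.split_cons (Ev.var rfl)
          (Ev.ifLE_false (Ev.add (Ev.call (Ev.cons (Ev.var rfl) (Ev.var rfl)) rfl hxe)
            (Ev.call (Ev.cons (Ev.var rfl) (Ev.var rfl)) rfl hye)) (Ev.const Rat.cast_zero)
            (lt_of_not_ge (mt hkeys.1 hc)) (Ev.cons (Ev.var rfl)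
              (Ev.call (Ev.cons (Ev.var rfl) (Ev.var rfl)) rfl ih))))))))))
      · omega

/-- The state after serving the target `zt` with the choices `pa` and `pb`. -/
noncomputable def SearchState.next (st : SearchState α β) (zt : ℝ × β)
    (pa pb : (ℝ × α) × List (ℝ × α)) : SearchState α β where
  cost := st.cost + zt.1 / (pa.1.1 + pb.1.1)
  left := pa.2
  right := pb.2
  out := (zt.2, pa.1.2, pb.1.2) :: st.out

theorem length_foldr_insertState_le (sts acc : List (SearchState α β)) :
    (sts.foldr insertState acc).length ≤ sts.length + acc.length := by
  induction sts with
  | nil => simp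
  | cons st sts ih =>
    have := length_insertState_le st (sts.foldr insertState acc)
    simp only [List.foldr_cons, List.length_cons]
    omega

theorem combine_ev (ea : α → Val) (eb : β → Val) (st : SearchState α β) (zt : ℝ × β)
    (pa : (ℝ × α) × List (ℝ × α)) (pbs : List ((ℝ × α) × List (ℝ × α)))
    (acc : List (SearchState α β)) {n M : ℕ} (hpa : pa.2.length ≤ n)
    (hpbs : ∀ pb ∈ pbs, pb.2.length ≤ n) (hM : acc.length + pbs.length ≤ M)
    (hpos : ∀ pb ∈ pbs, pa.1.1 + pb.1.1 ≠ 0) :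
    Ev procs [.cons (.cons (encElem eb zt) (.cons (.cons (encElem ea pa.1) (encList ea pa.2))
        (.cons (.num st.cost) (encOut ea eb st.out))))
        (.cons (encPicks ea pbs) (encStates ea eb acc))] combineBody
      (encStates ea eb ((pbs.map fun pb => st.next zt pa pb).foldr insertState acc))
      (200 * ((n + 1) * (M + 1)) * (pbs.length + 1)) := by
  have hX : 1 ≤ (n + 1) * (M + 1) := Nat.mul_pos (by omega) (by omega)
  induction pbs with
  | nil =>
    apply Ev.mono
    · exact Ev.split_cons (Ev.var rfl) (Ev.split_cons (Ev.var rfl) (Ev.split_nil (Ev.var rfl)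
        (Ev.var rfl)))
    · simp only [List.length_nil]; omega
  | cons pb pbs ih =>
    simp only [List.mem_cons, forall_eq_or_imp, List.length_cons] at hpbs hM hpos
    have ih := ih hpbs.2 (by omega) hpos.2
    have hins := insertState_ev ea eb (st.next zt pa pb)
      ((pbs.map fun pb => st.next zt pa pb).foldr insertState acc) hpa hpbs.1
    have hlen := length_foldr_insertState_le (pbs.map fun pb => st.next zt pa pb) acc
    rw [List.length_map] at hlen
    replace hins := hins.mono (b := 120 * ((n + 1) * (M + 1))) (by
      rw [← mul_assoc]; gcongr; omega)
    apply Ev.mono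
    · exact Ev.split_cons (Ev.var rfl) (Ev.split_cons (Ev.var rfl) (Ev.split_cons (Ev.var rfl)
          (Ev.split_cons (Ev.var rfl) (Ev.split_cons (Ev.var rfl) (Ev.split_cons (Ev.var rfl)
          (Ev.split_cons (Ev.var rfl) (Ev.split_cons (Ev.var rfl) (Ev.split_cons (Ev.var rfl)
          (Ev.split_cons (Ev.var rfl) (Ev.split_cons (Ev.var rfl) (Ev.call (Ev.cons
            (Ev.cons (Ev.add (Ev.var rfl) (Ev.div (Ev.var rfl) (Ev.add (Ev.var rfl) (Ev.var rfl))
              hpos.1))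
              (Ev.cons (Ev.var rfl) (Ev.cons (Ev.var rfl) (Ev.cons (Ev.cons (Ev.var rfl)
                (Ev.cons (Ev.var rfl) (Ev.var rfl))) (Ev.var rfl)))))
            (Ev.call (Ev.cons (Ev.var rfl) (Ev.cons (Ev.var rfl) (Ev.var rfl))) rfl ih))
            rfl hins)))))))))))
    · simp only [List.length_cons]; rw [mul_add _ (pbs.length + 1) 1]; omega

/-- The successors of a state for given choices on the two sides. -/
noncomputable def SearchState.nexts (st : SearchState α β) (zt : ℝ × β)
    (pas pbs : List ((ℝ × α) × List (ℝ × α))) : List (SearchState α β) :=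
  pas.flatMap fun pa => pbs.map fun pb => st.next zt pa pb

theorem SearchState.length_nexts (st : SearchState α β) (zt : ℝ × β)
    (pas pbs : List ((ℝ × α) × List (ℝ × α))) :
    (st.nexts zt pas pbs).length = pas.length * pbs.length := by
  simp [nexts]

theorem combineAll_ev (ea : α → Val) (eb : β → Val) (st : SearchState α β) (zt : ℝ × β)
    (pas pbs : List ((ℝ × α) × List (ℝ × α))) (acc : List (SearchState α β)) {n M : ℕ}
    (hpas : ∀ pa ∈ pas, pa.2.length ≤ n) (hpbs : ∀ pb ∈ pbs, pb.2.length ≤ n)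
    (hM : acc.length + pas.length * pbs.length ≤ M)
    (hpos : ∀ pa ∈ pas, ∀ pb ∈ pbs, pa.1.1 + pb.1.1 ≠ 0) :
    Ev procs [.cons (encElem eb zt) (.cons (encPicks ea pas) (.cons (encPicks ea pbs)
        (.cons (.cons (.num st.cost) (encOut ea eb st.out)) (encStates ea eb acc))))]
      combineAllBody
      (encStates ea eb ((st.nexts zt pas pbs).foldr insertState acc))
      ((200 * ((n + 1) * (M + 1)) * (pbs.length + 1) + 60) * (pas.length + 1)) := by
  induction pas with
  | nil =>
    apply Ev.mono
    · exact Ev.split_cons (Ev.var rfl) (Ev.split_cons (Ev.var rfl) (Ev.split_cons (Ev.var rfl)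
        (Ev.split_cons (Ev.var rfl) (Ev.split_nil (Ev.var rfl) (Ev.var rfl)))))
    · simp only [List.length_nil]; omega
  | cons pa pas ih =>
    simp only [List.mem_cons, forall_eq_or_imp, List.length_cons] at hpas hM hpos
    rw [add_mul, one_mul] at hM
    have ih := ih hpas.2 (by omega) hpos.2
    have hlen := length_foldr_insertState_le (st.nexts zt pas pbs) acc
    rw [st.length_nexts] at hlen
    have hcomb := combine_ev ea eb st zt pa pbs ((st.nexts zt pas pbs).foldr insertState acc)
      hpas.1 hpbs (M := M) (by omega) hpos.1
    rw [← List.foldr_append] at hcomb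
    apply Ev.mono
    · exact Ev.split_cons (Ev.var rfl) (Ev.split_cons (Ev.var rfl) (Ev.split_cons (Ev.var rfl)
        (Ev.split_cons (Ev.var rfl) (Ev.split_cons (Ev.var rfl) (Ev.call (Ev.cons
          (Ev.cons (Ev.var rfl) (Ev.cons (Ev.var rfl) (Ev.var rfl)))
          (Ev.cons (Ev.var rfl) (Ev.call (Ev.cons (Ev.var rfl) (Ev.cons (Ev.var rfl)
            (Ev.cons (Ev.var rfl) (Ev.cons (Ev.var rfl) (Ev.var rfl))))) rfl ih)))
          rfl hcomb)))))
    · simp only [List.length_cons]; rw [mul_add _ (pas.length + 1) 1]; omega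

/-- The successors of a state in which the target `zt` is served. -/
noncomputable def SearchState.expand (kappa : ℝ) (zt : ℝ × β) (st : SearchState α β) :
    List (SearchState α β) :=
  match st.left, st.right with
  | x :: l, y :: r =>
    st.nexts zt (picks (kappa * (x.1 + y.1)) (x :: l)) (picks (kappa * (x.1 + y.1)) (y :: r))
  | _, _ => []

/-- The successors of a list of states, without redundant states. -/
noncomputable def expandStates (kappa : ℝ) (zt : ℝ × β) (sts : List (SearchState α β)) :
    List (SearchState α β) :=
  sts.foldr (fun st acc => (st.expand kappa zt).foldr insertState acc) []

theorem length_snd_of_mem_picks {tau : ℝ} {l : List (ℝ × α)} {p : (ℝ × α) × List (ℝ × α)}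
    (hp : p ∈ picks tau l) : p.2.length + 1 = l.length := by
  fun_induction picks tau l generalizing p with
  | case1 => simp at hp
  | case2 x => simp_all
  | case3 x y l hc ih =>
    rw [List.mem_cons, List.mem_map] at hp
    rcases hp with rfl | ⟨q, hq, rfl⟩
    · simp
    · simpa using ih hq
  | case4 x y l hc ih =>
    rw [List.mem_map] at hp
    obtain ⟨q, hq, rfl⟩ := hp
    simpa using ih hq

theorem fst_mem_of_mem_picks {tau : ℝ} {l : List (ℝ × α)} {p : (ℝ × α) × List (ℝ × α)}
    (hp : p ∈ picks tau l) : p.1 ∈ l := by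
  fun_induction picks tau l generalizing p with
  | case1 => simp at hp
  | case2 x => simp_all
  | case3 x y l hc ih =>
    rw [List.mem_cons, List.mem_map] at hp
    rcases hp with rfl | ⟨q, hq, rfl⟩
    · simp
    · have := ih hq
      exact List.mem_cons_of_mem _ this
  | case4 x y l hc ih =>
    rw [List.mem_map] at hp
    obtain ⟨q, hq, rfl⟩ := hp
    have := ih hq
    exact List.mem_cons_of_mem _ this

/-- The states to which the program can be applied, with at most `n` elements on each side. -/
structure SearchState.Valid (n : ℕ) (st : SearchState α β) : Prop where
  left_le : st.left.length ≤ n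
  right_le : st.right.length ≤ n
  left_nonneg : ∀ x ∈ st.left, 0 ≤ x.1
  right_pos : ∀ y ∈ st.right, 0 < y.1

theorem SearchState.length_expand_le (kappa : ℝ) (zt : ℝ × β) {st : SearchState α β} {n : ℕ}
    (h : st.Valid n) : (st.expand kappa zt).length ≤ n ^ 2 := by
  obtain ⟨h1, h2, -, -⟩ := h
  rw [SearchState.expand]
  split
  · next x l y r hl hr =>
    rw [hl] at h1
    rw [hr] at h2
    rw [st.length_nexts, sq]
    exact Nat.mul_le_mul ((length_picks_le _ _).trans h1) ((length_picks_le _ _).trans h2)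
  · simp

theorem length_expandStates_le (kappa : ℝ) (zt : ℝ × β) {sts : List (SearchState α β)} {n : ℕ}
    (h : ∀ st ∈ sts, st.Valid n) : (expandStates kappa zt sts).length ≤ sts.length * n ^ 2 := by
  induction sts with
  | nil => simp [expandStates]
  | cons st sts ih =>
    rw [List.forall_mem_cons] at h
    have h1 := length_foldr_insertState_le (st.expand kappa zt) (expandStates kappa zt sts)
    have h2 := SearchState.length_expand_le kappa zt h.1
    have h3 := ih h.2
    rw [List.length_cons, add_mul, one_mul]
    exact h1.trans (by omega)

theorem expandStates_ev (ea : α → Val) (eb : β → Val) (kappa : ℝ) (zt : ℝ × β)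
    (sts : List (SearchState α β)) {n M : ℕ} (hst : ∀ st ∈ sts, st.Valid n)
    (hM : sts.length * n ^ 2 ≤ M) :
    Ev procs [.cons (.num kappa) (.cons (encElem eb zt) (encStates ea eb sts))] expandBody
      (encStates ea eb (expandStates kappa zt sts))
      (500 * ((n + 1) ^ 3 * (M + 1)) * (sts.length + 1)) := by
  have hX : 1 ≤ (n + 1) ^ 3 * (M + 1) := Nat.mul_pos (by positivity) (by omega)
  induction sts with
  | nil =>
    apply Ev.mono
    · exact Ev.split_cons (Ev.var rfl) (Ev.split_cons (Ev.var rfl) (Ev.split_nil (Ev.var rfl)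
        Ev.nil))
    · simp only [List.length_nil]; omega
  | cons st sts ih =>
    rw [List.forall_mem_cons] at hst
    rw [List.length_cons, add_mul, one_mul] at hM
    have ih := ih hst.2 (by omega)
    obtain ⟨c, left, right, out⟩ := st
    have hv := hst.1
    have hlen := length_expandStates_le kappa zt hst.2
    rw [List.length_cons, mul_add _ (sts.length + 1) 1]
    rw [expandStates, List.foldr_cons, ← expandStates]
    cases left with
    | nil =>
      apply Ev.mono
      · exact Ev.split_cons (Ev.var rfl) (Ev.split_cons (Ev.var rfl) (Ev.split_cons (Ev.var rfl)
          (Ev.split_cons (Ev.var rfl) (Ev.split_cons (Ev.var rfl) (Ev.split_cons (Ev.var rfl)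
          (Ev.split_nil (Ev.var rfl) (Ev.call (Ev.cons (Ev.var rfl) (Ev.cons (Ev.var rfl)
            (Ev.var rfl))) rfl ih)))))))
      · omega
    | cons x l =>
      cases right with
      | nil =>
        apply Ev.mono
        · exact Ev.split_cons (Ev.var rfl) (Ev.split_cons (Ev.var rfl) (Ev.split_cons (Ev.var rfl)
            (Ev.split_cons (Ev.var rfl) (Ev.split_cons (Ev.var rfl) (Ev.split_cons (Ev.var rfl)
            (Ev.split_cons (Ev.var rfl) (Ev.split_cons (Ev.var rfl) (Ev.split_nil (Ev.var rfl)
            (Ev.call (Ev.cons (Ev.var rfl) (Ev.cons (Ev.var rfl) (Ev.var rfl))) rfl ih)))))))))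
        · omega
      | cons y r =>
        obtain ⟨h1, h2, h3, h4⟩ := hv
        dsimp only at h1 h2 h3 h4
        have e1 := length_picks_le (kappa * (x.1 + y.1)) (x :: l)
        have e2 := length_picks_le (kappa * (x.1 + y.1)) (y :: r)
        have f1 := (picks_ev ea (kappa * (x.1 + y.1)) (x :: l)).mono
          (b := 30 * ((n + 1) ^ 3 * (M + 1))) (by
            calc 30 * ((x :: l).length + 1) ^ 2 ≤ 30 * ((n + 1) ^ 3 * 1) := by
                  rw [mul_one]
                  gcongr 30 * ?_
                  exact (Nat.pow_le_pow_left (by omega) 2).trans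
                    (Nat.pow_le_pow_right (by omega) (by omega))
              _ ≤ _ := by gcongr; omega)
        have f2 := (picks_ev ea (kappa * (x.1 + y.1)) (y :: r)).mono
          (b := 30 * ((n + 1) ^ 3 * (M + 1))) (by
            calc 30 * ((y :: r).length + 1) ^ 2 ≤ 30 * ((n + 1) ^ 3 * 1) := by
                  rw [mul_one]
                  gcongr 30 * ?_
                  exact (Nat.pow_le_pow_left (by omega) 2).trans
                    (Nat.pow_le_pow_right (by omega) (by omega))
              _ ≤ _ := by gcongr; omega)
        have g := combineAll_ev ea eb ⟨c, x :: l, y :: r, out⟩ zt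
          (picks (kappa * (x.1 + y.1)) (x :: l)) (picks (kappa * (x.1 + y.1)) (y :: r))
          (expandStates kappa zt sts) (n := n) (M := M)
          (fun p hp => by have := length_snd_of_mem_picks hp; omega)
          (fun p hp => by have := length_snd_of_mem_picks hp; omega)
          (by
            have : (picks (kappa * (x.1 + y.1)) (x :: l)).length *
                (picks (kappa * (x.1 + y.1)) (y :: r)).length ≤ n ^ 2 := by
              rw [sq]; exact Nat.mul_le_mul (by omega) (by omega)
            omega)
          (fun pa ha pb hb => (add_pos_of_nonneg_of_pos (h3 _ (fst_mem_of_mem_picks ha))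
            (h4 _ (fst_mem_of_mem_picks hb))).ne')
        replace g := g.mono (b := 260 * ((n + 1) ^ 3 * (M + 1))) (by
          calc _ ≤ (200 * ((n + 1) * (M + 1)) * (n + 1) + 60 * ((n + 1) * (M + 1) * (n + 1)))
                  * (n + 1) := by
                gcongr
                · omega
                · have : 1 ≤ (n + 1) * (M + 1) * (n + 1) :=
                    Nat.mul_pos (Nat.mul_pos (by omega) (by omega)) (by omega)
                  omega
                · omega
            _ = _ := by ring)
        apply Ev.mono
        · exact Ev.split_cons (Ev.var rfl) (Ev.split_cons (Ev.var rfl) (Ev.split_cons (Ev.var rfl)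
            (Ev.split_cons (Ev.var rfl) (Ev.split_cons (Ev.var rfl) (Ev.split_cons (Ev.var rfl)
            (Ev.split_cons (Ev.var rfl) (Ev.split_cons (Ev.var rfl) (Ev.split_cons (Ev.var rfl)
            (Ev.split_cons (Ev.var rfl) (Ev.bind
              (Ev.mul (Ev.var rfl) (Ev.add (Ev.var rfl) (Ev.var rfl)))
              (Ev.call (Ev.cons (Ev.var rfl) (Ev.cons
                (Ev.call (Ev.cons (Ev.var rfl) (Ev.var rfl)) rfl f1) (Ev.cons
                (Ev.call (Ev.cons (Ev.var rfl) (Ev.var rfl)) rfl f2) (Ev.cons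
                (Ev.cons (Ev.var rfl) (Ev.var rfl))
                (Ev.call (Ev.cons (Ev.var rfl) (Ev.cons (Ev.var rfl) (Ev.var rfl))) rfl ih)))))
                rfl g)))))))))))
        · omega

/-- The states that are reached by serving the targets `zts` one after the other. -/
noncomputable def search (kappa : ℝ) (zts : List (ℝ × β)) (sts : List (SearchState α β)) :
    List (SearchState α β) :=
  zts.foldl (fun sts zt => expandStates kappa zt sts) sts

theorem search_ev (ea : α → Val) (eb : β → Val) (kappa : ℝ) (zts : List (ℝ × β))
    (sts : List (SearchState α β)) {n S : ℕ} {Inv : List (SearchState α β) → Prop}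
    (hinit : Inv sts) (hstep : ∀ zt sts, Inv sts → Inv (expandStates kappa zt sts))
    (hvalid : ∀ sts, Inv sts → ∀ st ∈ sts, st.Valid n)
    (hlen : ∀ sts, Inv sts → sts.length ≤ S) :
    Ev procs [.cons (.num kappa) (.cons (encList eb zts) (encStates ea eb sts))] loopBody
      (encStates ea eb (search kappa zts sts))
      ((500 * ((n + 1) ^ 3 * (S * n ^ 2 + 1)) * (S + 1) + 30) * (zts.length + 1)) := by
  induction zts generalizing sts with
  | nil =>
    apply Ev.mono
    · exact Ev.split_cons (Ev.var rfl) (Ev.split_cons (Ev.var rfl) (Ev.split_nil (Ev.var rfl)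
        (Ev.var rfl)))
    · simp only [List.length_nil]; omega
  | cons zt zts ih =>
    have h := (expandStates_ev ea eb kappa zt sts (M := S * n ^ 2) (hvalid sts hinit)
      (Nat.mul_le_mul_right _ (hlen sts hinit))).mono
      (b := 500 * ((n + 1) ^ 3 * (S * n ^ 2 + 1)) * (S + 1)) (by
        gcongr; exact hlen sts hinit)
    rw [List.length_cons, mul_add _ (zts.length + 1) 1]
    apply Ev.mono
    · exact Ev.split_cons (Ev.var rfl) (Ev.split_cons (Ev.var rfl) (Ev.split_cons (Ev.var rfl)
        (Ev.call (Ev.cons (Ev.var rfl) (Ev.cons (Ev.var rfl) (Ev.call (Ev.cons (Ev.var rfl)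
          (Ev.cons (Ev.var rfl) (Ev.var rfl))) rfl h))) rfl (ih _ (hstep zt sts hinit)))))
    · omega

theorem main_ev (eps : ℝ) (c : α → Plane) (t : β → Plane) (i j : α) (is : List α) (ks : List β)
    {w₀ w₁ : ℝ} (hw₀ : w₀ = c j 0 - c i 0) (hw₁ : w₁ = c j 1 - c i 1)
    {cams hi lo hi' : List (ℝ × α)} {zts : List (ℝ × β)} {e : ℝ × α}
    (hcams : cams = ((i :: j :: is).map fun i => (dotKey w₀ w₁ (c i), i)).insertionSort KeyGE)
    (hzts : zts = (ks.map fun k => (areaKey w₀ w₁ (c i) (t k), k)).insertionSort KeyGE)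
    (hk : ks.length ≤ (i :: j :: is).length)
    (hhi : hi = (cams.take ks.length).reverse) (hhi' : hi = e :: hi')
    (hlo : lo = cams.drop ks.length)
    {st : SearchState α β} {sts : List (SearchState α β)} {b : ℕ}
    (hres : search (eps / 16) zts [⟨0, roundList e.1 (1 + eps / 4) 0 hi [],
      roundList e.1 (1 + eps / 4) 0 lo [], []⟩] = st :: sts)
    (hsearch : Ev procs [.cons (.num (eps / 16)) (.cons (encList (fun k => Val.ofPoint (t k)) zts)
      (encStates (fun i => Val.ofPoint (c i)) (fun k => Val.ofPoint (t k))
      [⟨0, roundList e.1 (1 + eps / 4) 0 hi [], roundList e.1 (1 + eps / 4) 0 lo [], []⟩]))]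
      loopBody (encStates (fun i => Val.ofPoint (c i)) (fun k => Val.ofPoint (t k))
        (search (eps / 16) zts [⟨0, roundList e.1 (1 + eps / 4) 0 hi [],
          roundList e.1 (1 + eps / 4) 0 lo [], []⟩])) b) :
    Ev procs [.cons (.num eps) (.cons
      (Val.ofList ((i :: j :: is).map fun i => Val.ofPoint (c i)))
      (Val.ofList (ks.map fun k => Val.ofPoint (t k))))] mainExpr
      (encOut (fun i => Val.ofPoint (c i)) (fun k => Val.ofPoint (t k)) st.out)
      (100 * (ks.length + 1) ^ 2 + 60 * ((i :: j :: is).length + 1) ^ 2 + 30 * (ks.length + 1)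
        + 60 * (hi.length + 1) + 60 * (lo.length + 1) + b + 200) := by
  have h1 := sortTargets_ev w₀ w₁ (c i) t ks
  rw [← hzts] at h1
  have h2 := sortCameras_ev w₀ w₁ c (i :: j :: is)
  rw [← hcams] at h2
  have h3 := halve_ev (fun i => Val.ofPoint (c i)) (ks.map fun k => Val.ofPoint (t k)) cams []
    (by rw [hcams, List.length_insertionSort, List.length_map, List.length_map]; exact hk)
  rw [List.length_map, ← hlo, List.append_nil, ← hhi] at h3
  have h4 := round_ev (fun i => Val.ofPoint (c i)) e.1 (1 + eps / 4) 0 hi []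
  have h5 := round_ev (fun i => Val.ofPoint (c i)) e.1 (1 + eps / 4) 0 lo []
  rw [hres] at hsearch
  subst hw₀ hw₁
  rw [hhi'] at h3 h4 hsearch ⊢
  apply Ev.mono
  · exact Ev.split_cons (Ev.var rfl) (Ev.split_cons (Ev.var rfl) (Ev.split_cons (Ev.var rfl)
      (Ev.split_cons (Ev.var rfl) (Ev.split_cons (Ev.var rfl) (Ev.split_cons (Ev.var rfl)
      (Ev.bind (Ev.cons (Ev.sub (Ev.var rfl) (Ev.var rfl)) (Ev.sub (Ev.var rfl) (Ev.var rfl)))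
      (Ev.bind (Ev.call (Ev.cons (Ev.cons (Ev.var rfl) (Ev.var rfl)) (Ev.var rfl)) rfl h1)
      (Ev.bind (Ev.call (Ev.cons (Ev.var rfl) (Ev.cons
        (Ev.call (Ev.cons (Ev.var rfl) (Ev.var rfl)) rfl h2) Ev.nil)) rfl h3)
      (Ev.split_cons (Ev.var rfl) (Ev.split_cons (Ev.var rfl) (Ev.split_cons (Ev.var rfl)
      (Ev.bind (Ev.cons (Ev.var rfl) (Ev.add (Ev.const Rat.cast_one)
        (Ev.div (Ev.var rfl) (Ev.const (Rat.cast_ofNat 4)) (by norm_num))))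
      (Ev.bind (Ev.call (Ev.cons (Ev.div (Ev.var rfl) (Ev.const (Rat.cast_ofNat 16))
          (by norm_num)) (Ev.cons (Ev.var rfl) (Ev.cons (Ev.cons (Ev.const Rat.cast_zero)
        (Ev.cons (Ev.call (Ev.cons (Ev.var rfl) (Ev.cons (Ev.const Rat.cast_zero)
          (Ev.cons (Ev.var rfl) Ev.nil))) rfl h4)
        (Ev.cons (Ev.call (Ev.cons (Ev.var rfl) (Ev.cons (Ev.const Rat.cast_zero)
          (Ev.cons (Ev.var rfl) Ev.nil))) rfl h5) Ev.nil))) Ev.nil))) rfl hsearch)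
      (Ev.split_cons (Ev.var rfl) (Ev.split_cons (Ev.var rfl) (Ev.split_cons (Ev.var rfl)
      (Ev.split_cons (Ev.var rfl) (Ev.var rfl))))))))))))))))))
  · omega

/-! ## The number of states -/

theorem mem_picks_iff {tau : ℝ} {l : List (ℝ × α)} {p : (ℝ × α) × List (ℝ × α)} :
    p ∈ picks tau l ↔
      ∃ l₁ l₂, l = l₁ ++ p.1 :: l₂ ∧ p.2 = l₁ ++ l₂ ∧ (tau ≤ p.1.1 ∨ l₂ = []) := by
  have key : ∀ (p : (ℝ × α) × List (ℝ × α)) x y (l : List (ℝ × α)), (∀ {p}, p ∈ picks tau (y :: l) ↔ ∃ l₁ l₂,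
      y :: l = l₁ ++ p.1 :: l₂ ∧ p.2 = l₁ ++ l₂ ∧ (tau ≤ p.1.1 ∨ l₂ = [])) →
      ((∃ l₁ l₂, x :: y :: l = l₁ ++ p.1 :: l₂ ∧ p.2 = l₁ ++ l₂ ∧ (tau ≤ p.1.1 ∨ l₂ = [])) ↔
        (tau ≤ x.1 ∧ p = (x, y :: l)) ∨
        p ∈ (picks tau (y :: l)).map fun p => (p.1, x :: p.2)) := by
    intro p x y l ih
    rw [List.mem_map]
    constructor
    · rintro ⟨l₁, l₂, h1, h2, h3⟩
      cases l₁ with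
      | nil =>
        left
        rw [List.nil_append, List.cons.injEq] at h1
        obtain ⟨h1, rfl⟩ := h1
        rw [List.nil_append] at h2
        refine ⟨by simpa [h1] using h3, ?_⟩
        rw [h1, ← h2]
      | cons z l₁ =>
        right
        rw [List.cons_append, List.cons.injEq] at h1
        obtain ⟨rfl, h1⟩ := h1
        exact ⟨(p.1, l₁ ++ l₂), ih.2 ⟨l₁, l₂, h1, rfl, h3⟩, Prod.ext rfl h2.symm⟩
    · rintro (⟨h, rfl⟩ | ⟨q, hq, rfl⟩)
      · exact ⟨[], y :: l, rfl, rfl, .inl h⟩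
      · obtain ⟨l₁, l₂, h1, h2, h3⟩ := ih.1 hq
        exact ⟨x :: l₁, l₂, by simp [h1], by simp [h2], h3⟩
  fun_induction picks tau l generalizing p with
  | case1 => simp
  | case2 x =>
    rw [List.mem_singleton]
    constructor
    · rintro rfl
      exact ⟨[], [], rfl, rfl, .inr rfl⟩
    · rintro ⟨l₁, l₂, h1, h2, -⟩
      obtain ⟨rfl, h1⟩ | ⟨h1, h1'⟩ := List.cons_eq_append_iff.1 h1
      · simp_all [Prod.ext_iff]
      · simp at h1'
  | case3 x y l hc ih =>
    rw [key p x y l ih, List.mem_cons]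
    simp [hc]
  | case4 x y l hc ih =>
    rw [key p x y l ih]
    simp [hc]

theorem sublist_of_mem_picks {tau : ℝ} {l : List (ℝ × α)} {p : (ℝ × α) × List (ℝ × α)}
    (hp : p ∈ picks tau l) : p.2.Sublist l := by
  obtain ⟨l₁, l₂, rfl, h, -⟩ := mem_picks_iff.1 hp
  rw [h]
  exact (List.sublist_cons_self _ _).append_left l₁

open Classical in
theorem filter_prefix_of_mem_picks {tau : ℝ} {l : List (ℝ × α)} {p : (ℝ × α) × List (ℝ × α)}
    (hp : p ∈ picks tau l) : p.2.filter (·.1 < tau) <+: l.filter (·.1 < tau) := by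
  obtain ⟨l₁, l₂, rfl, h, h' | rfl⟩ := mem_picks_iff.1 hp
  · rw [h, List.filter_append, List.filter_append, List.filter_cons_of_neg (by simpa using h')]
  · rw [h, List.append_nil, List.filter_append]
    exact List.prefix_append _ _

theorem forall_mem_insertState {st : SearchState α β} {acc : List (SearchState α β)}
    {p : SearchState α β → Prop} (h : p st) (hacc : ∀ x ∈ acc, p x) :
    ∀ x ∈ insertState st acc, p x := by
  fun_induction insertState st acc <;> simp_all

open Classical in
theorem map_keys_insertState (st : SearchState α β) (acc : List (SearchState α β)) :
    (insertState st acc).map SearchState.keys =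
      if st.keys ∈ acc.map SearchState.keys then acc.map SearchState.keys
      else acc.map SearchState.keys ++ [st.keys] := by
  fun_induction insertState st acc with
  | case1 => simp
  | case2 h t hk hc => simp [hk]
  | case3 h t hk hc => simp [hk]
  | case4 h t hk ih =>
    rw [List.map_cons, ih, List.map_cons]
    simp only [List.mem_cons, hk, false_or]
    split_ifs <;> simp

theorem nodup_keys_insertState {st : SearchState α β} {acc : List (SearchState α β)}
    (h : (acc.map SearchState.keys).Nodup) :
    ((insertState st acc).map SearchState.keys).Nodup := by
  rw [map_keys_insertState]
  split_ifs with hk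
  · exact h
  · rw [← List.concat_eq_append]
    exact h.concat hk

/-- The list of states `sts` contains a state which is at least as good as `y`. -/
def Dominates (sts : List (SearchState α β)) (y : SearchState α β) : Prop :=
  ∃ x ∈ sts, x.keys = y.keys ∧ x.cost ≤ y.cost

theorem dominates_insertState {st y : SearchState α β} {acc : List (SearchState α β)}
    (hy : y = st ∨ Dominates acc y) : Dominates (insertState st acc) y := by
  unfold Dominates at hy ⊢
  fun_induction insertState st acc with
  | case1 => simp_all
  | case2 h t hk hc =>
    rcases hy with rfl | ⟨x, hx, h1, h2⟩
    · exact ⟨y, by simp, rfl, le_rfl⟩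
    · rcases List.mem_cons.1 hx with rfl | hx
      · exact ⟨st, by simp, hk.trans h1, hc.trans h2⟩
      · exact ⟨x, by simp [hx], h1, h2⟩
  | case3 h t hk hc =>
    rcases hy with rfl | hy
    · exact ⟨h, by simp, hk.symm, (lt_of_not_ge hc).le⟩
    · exact hy
  | case4 h t hk ih =>
    have key : (y = st ∨ ∃ x ∈ t, x.keys = y.keys ∧ x.cost ≤ y.cost) → ∃ x ∈ h :: insertState st t, x.keys = y.keys ∧
        x.cost ≤ y.cost := fun h' => by
      obtain ⟨x, hx, hx'⟩ := ih h'
      exact ⟨x, by simp [hx], hx'⟩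
    rcases hy with rfl | ⟨x, hx, h'⟩
    · exact key (.inl rfl)
    · rcases List.mem_cons.1 hx with rfl | hx
      · exact ⟨x, by simp, h'⟩
      · exact key (.inr ⟨x, hx, h'⟩)

theorem foldr_insertState_expand (kappa : ℝ) (zt : ℝ × β) (sts : List (SearchState α β)) :
    expandStates kappa zt sts =
      (sts.flatMap fun st => st.expand kappa zt).foldr insertState [] := by
  induction sts with
  | nil => rfl
  | cons st sts ih =>
    rw [List.flatMap_cons, List.foldr_append, ← ih]
    rfl

theorem forall_mem_expandStates {kappa : ℝ} {zt : ℝ × β} {sts : List (SearchState α β)}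
    {p : SearchState α β → Prop} (h : ∀ st ∈ sts, ∀ x ∈ st.expand kappa zt, p x) :
    ∀ x ∈ expandStates kappa zt sts, p x := by
  rw [foldr_insertState_expand]
  have h' : ∀ x ∈ sts.flatMap fun st => st.expand kappa zt, p x := by
    simpa only [List.mem_flatMap, forall_exists_index, and_imp, forall_comm (α := SearchState α β)]
      using fun st hst x hx => h st hst x hx
  revert h'
  generalize (sts.flatMap fun st => st.expand kappa zt) = l
  intro h'
  induction l with
  | nil => simp
  | cons a l ih =>
    rw [List.forall_mem_cons] at h'
    exact forall_mem_insertState h'.1 (ih h'.2)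

theorem nodup_keys_expandStates (kappa : ℝ) (zt : ℝ × β) (sts : List (SearchState α β)) :
    ((expandStates kappa zt sts).map SearchState.keys).Nodup := by
  rw [foldr_insertState_expand]
  induction sts.flatMap fun st => st.expand kappa zt with
  | nil => simp
  | cons a l ih => exact nodup_keys_insertState ih

theorem dominates_expandStates {kappa : ℝ} {zt : ℝ × β} {sts : List (SearchState α β)}
    {st y : SearchState α β} (hst : st ∈ sts) (hy : y ∈ st.expand kappa zt) :
    Dominates (expandStates kappa zt sts) y := by
  rw [foldr_insertState_expand]
  have h' : y ∈ sts.flatMap fun st => st.expand kappa zt := List.mem_flatMap.2 ⟨st, hst, hy⟩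
  revert h'
  generalize (sts.flatMap fun st => st.expand kappa zt) = l
  intro h'
  induction l with
  | nil => simp at h'
  | cons a l ih =>
    rcases List.mem_cons.1 h' with rfl | h'
    · exact dominates_insertState (.inl rfl)
    · exact dominates_insertState (.inr (ih h'))

/-- The list is descending, and different keys differ by more than the factor `lam`. -/
def Separated (lam : ℝ) (l : List (ℝ × α)) : Prop :=
  l.Pairwise fun x y => y.1 ≤ x.1 ∧ (y.1 = x.1 ∨ lam * y.1 < x.1)

theorem Separated.sortedGE {lam : ℝ} {l : List (ℝ × α)} (h : Separated lam l) :
    (l.map Prod.fst).Pairwise (· ≥ ·) :=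
  List.pairwise_map.2 (h.imp fun h => h.1)

theorem Separated.lt {lam : ℝ} {l : List (ℝ × α)} (h : Separated lam l) {x y : ℝ}
    (hx : x ∈ l.map Prod.fst) (hy : y ∈ l.map Prod.fst) (hxy : x < y) : lam * x < y := by
  rw [List.mem_map] at hx hy
  obtain ⟨x, hx, rfl⟩ := hx
  obtain ⟨y, hy, rfl⟩ := hy
  have key : l.Pairwise fun x y => (x.1 < y.1 → lam * x.1 < y.1) ∧
      (y.1 < x.1 → lam * y.1 < x.1) :=
    h.imp fun {x y} h => ⟨fun h' => absurd h' (not_lt.2 h.1), fun h' => h.2.resolve_left h'.ne⟩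
  have : Std.Symm fun x y : ℝ × α => (x.1 < y.1 → lam * x.1 < y.1) ∧
      (y.1 < x.1 → lam * y.1 < x.1) := ⟨fun x y h => ⟨h.2, h.1⟩⟩
  exact (key.forall_of_forall (fun x _ => ⟨fun h => absurd h (lt_irrefl _),
    fun h => absurd h (lt_irrefl _)⟩) hx hy).1 hxy

theorem mul_pow_card_le {lam tau B : ℝ} (hlam : 0 ≤ lam) {V : Finset ℝ}
    (hsep : ∀ x ∈ V, ∀ y ∈ V, x < y → lam * x < y) (htau : ∀ x ∈ V, tau ≤ x)
    (hB : tau ≤ B) (hVB : ∀ x ∈ V, lam * x ≤ B) : tau * lam ^ V.card ≤ B := by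
  induction V using Finset.induction_on_max generalizing B with
  | empty => simpa using hB
  | insert a s hs ih =>
    simp only [Finset.mem_insert, forall_eq_or_imp] at hsep htau hVB
    rw [Finset.card_insert_of_notMem fun h => (hs a h).false, pow_succ, ← mul_assoc, mul_comm]
    refine le_trans (mul_le_mul_of_nonneg_left ?_ hlam) hVB.1
    exact ih (fun x hx y hy => (hsep.2 x hx).2 y hy) htau.2 htau.1
      fun x hx => ((hsep.2 x hx).1 (hs x hx)).le

theorem card_keys_le {F : Finset (List ℝ)} {v₀ : List ℝ} {V : Finset ℝ} {n : ℕ} {tau S : ℝ}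
    (hn : v₀.length ≤ n) (hsorted : v₀.Pairwise (· ≥ ·))
    (hV : ∀ r ∈ v₀, tau ≤ r → r ≤ S → r ∈ V)
    (hF : ∀ v ∈ F, v.Sublist v₀ ∧ v.filter (· < tau) <+: v₀.filter (· < tau) ∧ ∀ r ∈ v, r ≤ S) :
    F.card ≤ (n + 1) ^ (V.card + 1) := by
  classical
  have hcard : (Finset.range (n + 1) ×ˢ
      Fintype.piFinset fun _ : V => Finset.range (n + 1)).card = (n + 1) ^ (V.card + 1) := by
    rw [Finset.card_product, Fintype.card_piFinset, Finset.prod_const, Finset.card_range,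
      Finset.card_univ, Fintype.card_coe, pow_succ']
  rw [← hcard]
  refine Finset.card_le_card_of_injOn
    (fun v => ((v.filter (· < tau)).length, fun r : V => v.count r.1)) ?_ ?_
  · intro v hv
    obtain ⟨h1, -, -⟩ := hF v hv
    simp only [Finset.coe_product, Set.mem_prod, Finset.mem_coe, Finset.mem_range,
      Fintype.mem_piFinset]
    have := h1.length_le
    exact ⟨by have := List.length_filter_le (· < tau) v; omega,
      fun r => by have := List.count_le_length (a := r.1) (l := v); omega⟩
  · intro v hv w hw hvw
    obtain ⟨v1, v2, v3⟩ := hF v hv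
    obtain ⟨w1, w2, w3⟩ := hF w hw
    rw [Prod.mk.injEq] at hvw
    have hfil : v.filter (· < tau) = w.filter (· < tau) :=
      (List.prefix_of_prefix_length_le v2 w2 hvw.1.le).eq_of_length hvw.1
    refine List.Perm.eq_of_pairwise (le := (· ≥ ·)) (fun a b _ _ h h' => le_antisymm h' h)
      (hsorted.sublist v1) (hsorted.sublist w1) (List.perm_iff_count.2 fun r => ?_)
    rcases lt_or_ge r tau with hr | hr
    · rw [← List.count_filter (p := (· < tau)) (l := v) (by simpa using hr), hfil,
        List.count_filter (by simpa using hr)]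
    · by_cases hrV : r ∈ V
      · exact congrFun hvw.2 ⟨r, hrV⟩
      · have : ∀ u : List ℝ, u.Sublist v₀ → (∀ r ∈ u, r ≤ S) → u.count r = 0 := fun u h1 h2 =>
          List.count_eq_zero_of_not_mem fun h => hrV (hV r (h1.subset h) hr (h2 r h))
        rw [this v v1 v3, this w w1 w3]

/-- The list `l` has been obtained from `a` by removing elements of key at least `tau`, and final
segments; its keys are at most `x`. -/
structure Reachable (tau x : ℝ) (a l : List (ℝ × α)) : Prop where
  sublist : l.Sublist a
  filter_prefix : (l.filter fun e => e.1 < tau) <+: a.filter fun e => e.1 < tau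
  le : ∀ e ∈ l, e.1 ≤ x

theorem Reachable.keys {tau x : ℝ} {a l : List (ℝ × α)} (h : Reachable tau x a l) :
    (l.map Prod.fst).Sublist (a.map Prod.fst) ∧
      (l.map Prod.fst).filter (· < tau) <+: (a.map Prod.fst).filter (· < tau) ∧
      ∀ r ∈ l.map Prod.fst, r ≤ x := by
  refine ⟨h.sublist.map _, ?_, ?_⟩
  · rw [List.filter_map, List.filter_map]
    exact h.filter_prefix.map Prod.fst
  · intro r hr
    obtain ⟨e, he, rfl⟩ := List.mem_map.1 hr
    exact h.le e he

theorem Reachable.pick {tau tau' x lam : ℝ} {a l : List (ℝ × α)} {e : ℝ × α}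
    (ha : Separated lam a) (h : Reachable tau x a (e :: l)) (htau : tau' ≤ tau)
    {p : (ℝ × α) × List (ℝ × α)} (hp : p ∈ picks tau' (e :: l)) : Reachable tau' e.1 a p.2 := by
  have hs := sublist_of_mem_picks hp
  refine ⟨hs.trans h.sublist, (filter_prefix_of_mem_picks hp).trans ?_, ?_⟩
  · have key : ∀ l : List (ℝ × α), (l.filter fun e => e.1 < tau') =
        (l.filter fun e => e.1 < tau).filter fun e => e.1 < tau' := fun l => by
      rw [List.filter_filter]
      refine List.filter_congr fun e _ => ?_
      by_cases h : e.1 < tau' <;> simp [h]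
      exact h.trans_le htau
    rw [key, key a]
    exact h.filter_prefix.filter _
  · intro f hf
    have h1 := (List.pairwise_cons.1 (ha.sublist h.sublist)).1
    rcases List.mem_cons.1 (hs.subset hf) with rfl | hf
    · exact le_rfl
    · exact (h1 f hf).1

/-- The states that can occur when the search starts with the lists `a` and `b`. -/
def SearchState.Inv (kappa : ℝ) (a b : List (ℝ × α)) (st : SearchState α β) : Prop :=
  ∃ x ∈ a.map Prod.fst, ∃ y ∈ b.map Prod.fst, Reachable (kappa * (x + y)) x a st.left ∧
    Reachable (kappa * (x + y)) y b st.right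

theorem SearchState.mem_expand_iff {kappa : ℝ} {zt : ℝ × β} {st s : SearchState α β} :
    s ∈ st.expand kappa zt ↔ ∃ x l y r, st.left = x :: l ∧ st.right = y :: r ∧
      ∃ pa ∈ picks (kappa * (x.1 + y.1)) (x :: l), ∃ pb ∈ picks (kappa * (x.1 + y.1)) (y :: r),
        s = st.next zt pa pb := by
  rw [SearchState.expand]
  split
  · next x l y r hl hr =>
    rw [hl, hr]
    simp only [SearchState.nexts, List.mem_flatMap, List.mem_map]
    constructor
    · rintro ⟨pa, hpa, pb, hpb, rfl⟩
      exact ⟨x, l, y, r, rfl, rfl, pa, hpa, pb, hpb, rfl⟩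
    · rintro ⟨x', l', y', r', h1, h2, pa, hpa, pb, hpb, rfl⟩
      cases h1
      cases h2
      exact ⟨pa, hpa, pb, hpb, rfl⟩
  · next h =>
    simp only [List.not_mem_nil, false_iff]
    rintro ⟨x, l, y, r, h1, h2, -⟩
    exact h x l y r h1 h2

theorem SearchState.Inv.expand {kappa lam : ℝ} {a b : List (ℝ × α)} {st s : SearchState α β}
    {zt : ℝ × β} (hkappa : 0 ≤ kappa) (ha : Separated lam a) (hb : Separated lam b)
    (h : st.Inv kappa a b) (hs : s ∈ st.expand kappa zt) : s.Inv kappa a b := by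
  obtain ⟨x, l, y, r, hl, hr, pa, hpa, pb, hpb, rfl⟩ := SearchState.mem_expand_iff.1 hs
  obtain ⟨x', -, y', -, h1, h2⟩ := h
  rw [hl] at h1
  rw [hr] at h2
  have hle : kappa * (x.1 + y.1) ≤ kappa * (x' + y') := by
    gcongr
    · exact h1.le x (by simp)
    · exact h2.le y (by simp)
  exact ⟨x.1, List.mem_map_of_mem (h1.sublist.subset (by simp)), y.1,
    List.mem_map_of_mem (h2.sublist.subset (by simp)), h1.pick ha hle hpa, h2.pick hb hle hpb⟩

theorem SearchState.Inv.valid {kappa : ℝ} {a b : List (ℝ × α)} {st : SearchState α β} {n : ℕ}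
    (ha : a.length ≤ n) (hb : b.length ≤ n) (ha0 : ∀ x ∈ a, 0 ≤ x.1) (hb0 : ∀ y ∈ b, 0 < y.1)
    (h : st.Inv kappa a b) : st.Valid n := by
  obtain ⟨x, -, y, -, h1, h2⟩ := h
  exact ⟨h1.sublist.length_le.trans ha, h2.sublist.length_le.trans hb,
    fun x hx => ha0 x (h1.sublist.subset hx), fun x hx => hb0 x (h2.sublist.subset hx)⟩

theorem length_states_le {kappa lam : ℝ} {a b : List (ℝ × α)} {n W : ℕ} (hkappa : 0 < kappa)
    (hlam : 1 < lam) (ha : Separated lam a) (hb : Separated lam b)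
    (han : a.length ≤ n) (hbn : b.length ≤ n) (ha0 : ∀ x ∈ a, 0 ≤ x.1)
    (hb0 : ∀ y ∈ b, 0 < y.1) (hW : lam / kappa < lam ^ W) (hkl : kappa ≤ lam)
    {sts : List (SearchState α β)} (hsts : ∀ st ∈ sts, st.Inv kappa a b)
    (hnodup : (sts.map SearchState.keys).Nodup) :
    sts.length ≤ n ^ 2 * ((n + 1) ^ (W + 1)) ^ 2 := by
  classical
  have hcount : ∀ (x y : ℝ), 0 < x + y → ∀ c : List (ℝ × α), Separated lam c → c.length ≤ n →
      ∀ F : Finset (List ℝ), (∀ v ∈ F, v.Sublist (c.map Prod.fst) ∧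
        v.filter (· < kappa * (x + y)) <+: (c.map Prod.fst).filter (· < kappa * (x + y)) ∧
        ∀ r ∈ v, r ≤ x + y) → F.card ≤ (n + 1) ^ (W + 1) := by
    intro x y hxy c hc hcn F hF
    set V : Finset ℝ :=
      (c.map Prod.fst).toFinset.filter fun r => kappa * (x + y) ≤ r ∧ r ≤ x + y with hV
    refine (card_keys_le (V := V) (by simpa using hcn) hc.sortedGE
      (fun r hr h1 h2 => by simp only [hV, Finset.mem_filter, List.mem_toFinset]; exact ⟨hr, h1, h2⟩)
      hF).trans (Nat.pow_le_pow_right (by omega) (Nat.succ_le_succ ?_))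
    have := mul_pow_card_le (lam := lam) (tau := kappa * (x + y)) (B := lam * (x + y)) (V := V)
      (by linarith)
      (fun x hx y hy hxy => by
        simp only [hV, Finset.mem_filter, List.mem_toFinset] at hx hy
        exact hc.lt hx.1 hy.1 hxy)
      (fun x hx => (Finset.mem_filter.1 hx).2.1) (by gcongr)
      (fun x hx => mul_le_mul_of_nonneg_left (Finset.mem_filter.1 hx).2.2 (by linarith))
    have h2 : lam ^ V.card ≤ lam / kappa := by
      rw [le_div_iff₀ hkappa]
      nlinarith
    exact ((pow_lt_pow_iff_right₀ hlam).1 (h2.trans_lt hW)).le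
  have hK : (sts.map SearchState.keys).toFinset.card = sts.length := by
    rw [List.toFinset_card_of_nodup hnodup, List.length_map]
  set K := (sts.map SearchState.keys).toFinset
  set G : ℝ × ℝ → Finset (List ℝ × List ℝ) := fun p => K.filter fun k =>
    (k.1.Sublist (a.map Prod.fst) ∧ k.1.filter (· < kappa * (p.1 + p.2)) <+:
      (a.map Prod.fst).filter (· < kappa * (p.1 + p.2)) ∧ ∀ r ∈ k.1, r ≤ p.1 + p.2) ∧
    (k.2.Sublist (b.map Prod.fst) ∧ k.2.filter (· < kappa * (p.1 + p.2)) <+: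
      (b.map Prod.fst).filter (· < kappa * (p.1 + p.2)) ∧ ∀ r ∈ k.2, r ≤ p.1 + p.2) with hG
  have ha0' : ∀ x ∈ a.map Prod.fst, 0 ≤ x := by simpa using ha0
  have hb0' : ∀ x ∈ b.map Prod.fst, 0 < x := by simpa using hb0
  have hsub : K ⊆ ((a.map Prod.fst).toFinset ×ˢ (b.map Prod.fst).toFinset).biUnion G := by
    intro k hk
    obtain ⟨st, hst, rfl⟩ := List.mem_map.1 (List.mem_toFinset.1 hk)
    obtain ⟨x, hx, y, hy, h1, h2⟩ := hsts st hst
    refine Finset.mem_biUnion.2 ⟨(x, y), by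
      rw [Finset.mem_product, List.mem_toFinset, List.mem_toFinset]; exact ⟨hx, hy⟩, ?_⟩
    rw [hG, Finset.mem_filter]
    have hx0 := ha0' x hx
    have hy0 := hb0' y hy
    exact ⟨hk, ⟨h1.keys.1, h1.keys.2.1, fun r hr => (h1.keys.2.2 r hr).trans (by linarith)⟩,
      h2.keys.1, h2.keys.2.1, fun r hr => (h2.keys.2.2 r hr).trans (by linarith)⟩
  rw [← hK]
  refine (Finset.card_le_card hsub).trans ((Finset.card_biUnion_le_card_mul _ _
    (((n + 1) ^ (W + 1)) ^ 2) ?_).trans (Nat.mul_le_mul_right _ ?_))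
  · rintro ⟨x, y⟩ hxy
    rw [Finset.mem_product, List.mem_toFinset, List.mem_toFinset] at hxy
    have hpos : 0 < x + y := add_pos_of_nonneg_of_pos (ha0' x hxy.1) (hb0' y hxy.2)
    refine (Finset.card_le_card (Finset.subset_product (s := G (x, y)))).trans ?_
    rw [Finset.card_product, sq]
    refine Nat.mul_le_mul (hcount x y hpos a ha han _ ?_) (hcount x y hpos b hb hbn _ ?_)
    · intro v hv
      obtain ⟨k, hk, rfl⟩ := Finset.mem_image.1 hv
      exact (Finset.mem_filter.1 hk).2.1
    · intro v hv
      obtain ⟨k, hk, rfl⟩ := Finset.mem_image.1 hv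
      exact (Finset.mem_filter.1 hk).2.2
  · rw [Finset.card_product, sq]
    exact Nat.mul_le_mul ((List.toFinset_card_le _).trans (by simpa using han))
      ((List.toFinset_card_le _).trans (by simpa using hbn))

/-! ## The quality of the best state -/

/-- The cost of a multiset of triples `(z, a, b)`. -/
noncomputable def matchCost (T : Multiset (ℝ × ℝ × ℝ)) : ℝ :=
  (T.map fun t => t.1 / (t.2.1 + t.2.2)).sum

theorem matchCost_cons (t : ℝ × ℝ × ℝ) (T : Multiset (ℝ × ℝ × ℝ)) :
    matchCost (t ::ₘ T) = t.1 / (t.2.1 + t.2.2) + matchCost T := by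
  simp [matchCost]

/-- `T` matches the numbers in `Z`, `A` and `B`, which satisfy the sign conditions. -/
structure IsMatching (Z A B : Multiset ℝ) (T : Multiset (ℝ × ℝ × ℝ)) : Prop where
  map_z : T.map (·.1) = Z
  map_a : T.map (·.2.1) = A
  map_b : T.map (·.2.2) = B
  z_nonneg : ∀ z ∈ Z, 0 ≤ z
  a_nonneg : ∀ a ∈ A, 0 ≤ a
  b_pos : ∀ b ∈ B, 0 < b

theorem IsMatching.mem {Z A B : Multiset ℝ} {T : Multiset (ℝ × ℝ × ℝ)} (h : IsMatching Z A B T)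
    {t : ℝ × ℝ × ℝ} (ht : t ∈ T) : 0 ≤ t.1 ∧ 0 ≤ t.2.1 ∧ 0 < t.2.2 :=
  ⟨h.z_nonneg _ (h.map_z ▸ Multiset.mem_map_of_mem _ ht),
    h.a_nonneg _ (h.map_a ▸ Multiset.mem_map_of_mem (fun t : ℝ × ℝ × ℝ => t.2.1) ht),
    h.b_pos _ (h.map_b ▸ Multiset.mem_map_of_mem (fun t : ℝ × ℝ × ℝ => t.2.2) ht)⟩

theorem exists_max_first {z : ℝ} {Z A B : Multiset ℝ} {T : Multiset (ℝ × ℝ × ℝ)}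
    (h : IsMatching (z ::ₘ Z) A B T) (hz : ∀ x ∈ Z, x ≤ z) :
    ∃ a b T', IsMatching (z ::ₘ Z) A B ((z, a, b) ::ₘ T') ∧
      matchCost ((z, a, b) ::ₘ T') ≤ matchCost T ∧ ∀ t ∈ T', t.2.1 + t.2.2 ≤ a + b := by
  have hz1 : z ∈ T.map (·.1) := by rw [h.map_z]; exact Multiset.mem_cons_self _ _
  obtain ⟨⟨z₁, a₁, b₁⟩, ht₁, rfl⟩ := Multiset.mem_map.1 hz1
  obtain ⟨⟨z₂, a₂, b₂⟩, ht₂, hmax⟩ := Multiset.exists_max_image (fun t : ℝ × ℝ × ℝ => t.2.1 + t.2.2)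
    (s := T) (by rintro rfl; simp at ht₁)
  dsimp only at hmax h hz
  obtain ⟨T₁, rfl⟩ := Multiset.exists_cons_of_mem ht₁
  rcases Multiset.mem_cons.1 ht₂ with heq | ht₂
  · cases heq
    exact ⟨a₁, b₁, T₁, h, le_rfl, fun t ht => hmax t (Multiset.mem_cons_of_mem ht)⟩
  · have hs₁ := h.mem ht₁
    have hs₂ := h.mem (Multiset.mem_cons_of_mem ht₂)
    obtain ⟨T₂, rfl⟩ := Multiset.exists_cons_of_mem ht₂
    have hz₂ : z₂ ≤ z₁ := by
      refine hz z₂ ?_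
      have := h.map_z
      rw [Multiset.map_cons, Multiset.cons_inj_right] at this
      rw [← this]
      simp
    have hlen := hmax _ (Multiset.mem_cons_self _ _)
    dsimp only at hs₁ hs₂ hlen
    refine ⟨a₂, b₂, (z₂, a₁, b₁) ::ₘ T₂, ⟨?_, ?_, ?_, h.z_nonneg, h.a_nonneg, h.b_pos⟩, ?_, ?_⟩
    · rw [← h.map_z]; simp
    · rw [← h.map_a]; simp [Multiset.cons_swap]
    · rw [← h.map_b]; simp [Multiset.cons_swap]
    · simp only [matchCost_cons]
      have e : (a₂ + b₂)⁻¹ ≤ (a₁ + b₁)⁻¹ := by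
        apply inv_anti₀ <;> linarith
      simp only [div_eq_mul_inv]
      nlinarith
    · intro t ht
      rcases Multiset.mem_cons.1 ht with rfl | ht
      · exact hlen
      · exact hmax t (by simp [ht])

theorem exists_swap_left {Z A B : Multiset ℝ} {T : Multiset (ℝ × ℝ × ℝ)} {z a b a' : ℝ}
    (h : IsMatching Z A B ((z, a, b) ::ₘ T)) (ha' : a' ∈ A) (hle : a' ≤ a) :
    ∃ T', IsMatching Z A B ((z, a', b) ::ₘ T') ∧ matchCost T' ≤ matchCost T := by
  rcases eq_or_ne a' a with rfl | hne
  · exact ⟨T, h, le_rfl⟩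
  have hA := h.map_a
  rw [Multiset.map_cons] at hA
  rw [← hA] at ha'
  obtain ⟨⟨z₂, a₂, b₂⟩, ht₂, rfl⟩ := Multiset.mem_map.1 ((Multiset.mem_cons.1 ha').resolve_left hne)
  have hs := h.mem (Multiset.mem_cons_of_mem ht₂)
  obtain ⟨T₂, rfl⟩ := Multiset.exists_cons_of_mem ht₂
  dsimp only at hs hle
  refine ⟨(z₂, a, b₂) ::ₘ T₂, ⟨?_, ?_, ?_, h.z_nonneg, h.a_nonneg, h.b_pos⟩, ?_⟩
  · rw [← h.map_z]; simp
  · rw [← h.map_a]; simp [Multiset.cons_swap]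
  · rw [← h.map_b]; simp
  · simp only [matchCost_cons]
    have hz₂ := hs.1
    have hpos : 0 < a₂ + b₂ := by linarith
    gcongr

theorem exists_swap_right {Z A B : Multiset ℝ} {T : Multiset (ℝ × ℝ × ℝ)} {z a b b' : ℝ}
    (h : IsMatching Z A B ((z, a, b) ::ₘ T)) (hb' : b' ∈ B) (hle : b' ≤ b) :
    ∃ T', IsMatching Z A B ((z, a, b') ::ₘ T') ∧ matchCost T' ≤ matchCost T := by
  rcases eq_or_ne b' b with rfl | hne
  · exact ⟨T, h, le_rfl⟩
  have hB := h.map_b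
  rw [Multiset.map_cons] at hB
  rw [← hB] at hb'
  obtain ⟨⟨z₂, a₂, b₂⟩, ht₂, rfl⟩ := Multiset.mem_map.1 ((Multiset.mem_cons.1 hb').resolve_left hne)
  have hs := h.mem (Multiset.mem_cons_of_mem ht₂)
  obtain ⟨T₂, rfl⟩ := Multiset.exists_cons_of_mem ht₂
  dsimp only at hs hle
  refine ⟨(z₂, a₂, b) ::ₘ T₂, ⟨?_, ?_, ?_, h.z_nonneg, h.a_nonneg, h.b_pos⟩, ?_⟩
  · rw [← h.map_z]; simp
  · rw [← h.map_a]; simp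
  · rw [← h.map_b]; simp [Multiset.cons_swap]
  · simp only [matchCost_cons]
    have hz₂ := hs.1
    have hpos : 0 < a₂ + b₂ := by linarith
    gcongr

/-- The keys of a list, as a multiset. -/
def keysOf (l : List (ℝ × α)) : Multiset ℝ := (l.map Prod.fst : List ℝ)

theorem keysOf_of_mem_picks {tau : ℝ} {l : List (ℝ × α)} {p : (ℝ × α) × List (ℝ × α)}
    (hp : p ∈ picks tau l) : keysOf l = p.1.1 ::ₘ keysOf p.2 := by
  obtain ⟨l₁, l₂, rfl, h, -⟩ := mem_picks_iff.1 hp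
  rw [keysOf, keysOf, h, Multiset.cons_coe, Multiset.coe_eq_coe, List.map_append, List.map_append,
    List.map_cons]
  exact List.perm_middle

theorem exists_pick {tau a : ℝ} {l : List (ℝ × α)} (htau : 0 ≤ tau)
    (hl : (l.map Prod.fst).Pairwise (· ≥ ·)) (hl0 : ∀ x ∈ keysOf l, 0 ≤ x) (ha : a ∈ keysOf l) :
    ∃ p ∈ picks tau l, p.1.1 ≤ a ∧ a - tau ≤ p.1.1 := by
  rw [keysOf, Multiset.mem_coe] at ha
  obtain ⟨e, he, rfl⟩ := List.mem_map.1 ha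
  rcases le_or_gt tau e.1 with h | h
  · obtain ⟨l₁, l₂, rfl⟩ := List.append_of_mem he
    exact ⟨(e, l₁ ++ l₂), mem_picks_iff.2 ⟨l₁, l₂, rfl, rfl, .inl h⟩, le_rfl, by linarith⟩
  · obtain rfl | ⟨l₁, f, rfl⟩ := List.eq_nil_or_concat' l
    · simp at he
    · refine ⟨(f, l₁), mem_picks_iff.2 ⟨l₁, [], rfl, by simp, .inr rfl⟩, ?_, ?_⟩
      · rcases List.mem_append.1 he with he | he
        · rw [List.map_append] at hl
          exact (List.pairwise_append.1 hl).2.2 _ (List.mem_map_of_mem he) _ (by simp)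
        · rw [List.mem_singleton.1 he]
      · have := hl0 f.1 (by simp [keysOf])
        dsimp only
        linarith

theorem exists_expand {kappa : ℝ} (hkappa : 0 < kappa) (hkappa' : 4 * kappa < 1)
    {st : SearchState α β} {zt : ℝ × β} {Z : Multiset ℝ} {T : Multiset (ℝ × ℝ × ℝ)}
    (hT : IsMatching (zt.1 ::ₘ Z) (keysOf st.left) (keysOf st.right) T) (hz : ∀ x ∈ Z, x ≤ zt.1)
    (hl : (st.left.map Prod.fst).Pairwise (· ≥ ·))
    (hr : (st.right.map Prod.fst).Pairwise (· ≥ ·)) :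
    ∃ s ∈ st.expand kappa zt, ∃ T', IsMatching Z (keysOf s.left) (keysOf s.right) T' ∧
      (1 - 4 * kappa) * s.cost + matchCost T' ≤ (1 - 4 * kappa) * st.cost + matchCost T := by
  obtain ⟨a, b, T₁, h₁, hc₁, hmax⟩ := exists_max_first hT hz
  have hmax' : ∀ t ∈ (zt.1, a, b) ::ₘ T₁, t.2.1 + t.2.2 ≤ a + b := by
    intro t ht
    rcases Multiset.mem_cons.1 ht with rfl | ht
    · exact le_rfl
    · exact hmax t ht
  have hA : ∀ x ∈ keysOf st.left, x ≤ a + b := by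
    intro x hx
    rw [← h₁.map_a] at hx
    obtain ⟨t, ht, rfl⟩ := Multiset.mem_map.1 hx
    have := h₁.mem ht
    have := hmax' t ht
    linarith
  have hB : ∀ x ∈ keysOf st.right, x ≤ a + b := by
    intro x hx
    rw [← h₁.map_b] at hx
    obtain ⟨t, ht, rfl⟩ := Multiset.mem_map.1 hx
    have := h₁.mem ht
    have := hmax' t ht
    linarith
  have ha : a ∈ keysOf st.left := by rw [← h₁.map_a]; simp
  have hb : b ∈ keysOf st.right := by rw [← h₁.map_b]; simp
  have hA0 := h₁.a_nonneg
  have hB0 := h₁.b_pos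
  have hz0 := h₁.z_nonneg zt.1 (by simp)
  rcases hleft : st.left with _ | ⟨x, l⟩
  · rw [hleft] at ha; simp [keysOf] at ha
  rcases hright : st.right with _ | ⟨y, r⟩
  · rw [hright] at hb; simp [keysOf] at hb
  rw [hleft] at hA hA0 ha h₁ hl
  rw [hright] at hB hB0 hb h₁ hr
  have hx0 := hA0 x.1 (by simp [keysOf])
  have hx1 := hA x.1 (by simp [keysOf])
  have hy0 := hB0 y.1 (by simp [keysOf])
  have hy1 := hB y.1 (by simp [keysOf])
  set tau := kappa * (x.1 + y.1) with htau_def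
  have htau : 0 ≤ tau := by positivity
  obtain ⟨pa, hpa, hpa1, hpa2⟩ := exists_pick htau hl hA0 ha
  obtain ⟨pb, hpb, hpb1, hpb2⟩ := exists_pick htau hr (fun x hx => (hB0 x hx).le) hb
  obtain ⟨T₂, h₂, hc₂⟩ := exists_swap_left h₁
    (by rw [keysOf_of_mem_picks hpa]; exact Multiset.mem_cons_self _ _) hpa1
  obtain ⟨T₃, h₃, hc₃⟩ := exists_swap_right h₂
    (by rw [keysOf_of_mem_picks hpb]; exact Multiset.mem_cons_self _ _) hpb1
  refine ⟨st.next zt pa pb, SearchState.mem_expand_iff.2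
    ⟨x, l, y, r, hleft, hright, pa, hpa, pb, hpb, rfl⟩, T₃, ⟨?_, ?_, ?_, ?_, ?_, ?_⟩, ?_⟩
  · simpa using h₃.map_z
  · have := h₃.map_a
    rw [keysOf_of_mem_picks hpa, Multiset.map_cons] at this
    exact (Multiset.cons_inj_right _).1 this
  · have := h₃.map_b
    rw [keysOf_of_mem_picks hpb, Multiset.map_cons] at this
    exact (Multiset.cons_inj_right _).1 this
  · exact fun z hz => h₃.z_nonneg z (Multiset.mem_cons_of_mem hz)
  · refine fun z hz => h₃.a_nonneg z ?_
    rw [keysOf_of_mem_picks hpa]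
    exact Multiset.mem_cons_of_mem hz
  · refine fun z hz => h₃.b_pos z ?_
    rw [keysOf_of_mem_picks hpb]
    exact Multiset.mem_cons_of_mem hz
  · have hs := h₃.mem (Multiset.mem_cons_self _ _)
    dsimp only at hs
    rw [matchCost_cons] at hc₁
    have hab : 0 < a + b := by linarith
    have key : (1 - 4 * kappa) * (zt.1 / (pa.1.1 + pb.1.1)) ≤ zt.1 / (a + b) := by
      rw [← mul_div_assoc, div_le_div_iff₀ (by linarith) hab]
      have : (1 - 4 * kappa) * (a + b) ≤ pa.1.1 + pb.1.1 := by nlinarith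
      nlinarith
    simp only [SearchState.next]
    linarith

theorem exists_mem_search {kappa : ℝ} (hkappa : 0 < kappa) (hkappa' : 4 * kappa < 1)
    {zts : List (ℝ × β)} (hzts : (zts.map Prod.fst).Pairwise (· ≥ ·))
    {sts : List (SearchState α β)} {st : SearchState α β} (hst : st ∈ sts)
    {T : Multiset (ℝ × ℝ × ℝ)} (hT : IsMatching (keysOf zts) (keysOf st.left) (keysOf st.right) T)
    (hl : (st.left.map Prod.fst).Pairwise (· ≥ ·))
    (hr : (st.right.map Prod.fst).Pairwise (· ≥ ·)) :
    ∃ s ∈ search kappa zts sts,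
      (1 - 4 * kappa) * s.cost ≤ (1 - 4 * kappa) * st.cost + matchCost T := by
  induction zts generalizing sts st T with
  | nil =>
    refine ⟨st, hst, ?_⟩
    have : T = 0 := by simpa [keysOf] using hT.map_z
    simp [this, matchCost]
  | cons zt zts ih =>
    rw [List.map_cons, List.pairwise_cons] at hzts
    obtain ⟨s, hs, T', hT', hc⟩ := exists_expand hkappa hkappa'
      (Z := keysOf zts) hT hzts.1 hl hr
    obtain ⟨s', hs', hk, hc'⟩ := dominates_expandStates hst hs
    obtain ⟨x, l, y, r, hl', hr', pa, hpa, pb, hpb, hsn⟩ := SearchState.mem_expand_iff.1 hs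
    simp only [SearchState.keys, Prod.mk.injEq] at hk
    obtain ⟨u, hu, hcu⟩ := ih hzts.2 hs' (T := T')
      (by
        have e1 : keysOf s'.left = keysOf s.left := congrArg (fun l : List ℝ => (l : Multiset ℝ)) hk.1
        have e2 : keysOf s'.right = keysOf s.right := congrArg (fun l : List ℝ => (l : Multiset ℝ)) hk.2
        rw [e1, e2]
        exact hT')
      (by
        rw [hk.1, hsn]
        rw [hl'] at hl
        exact hl.sublist ((sublist_of_mem_picks hpa).map _))
      (by
        rw [hk.2, hsn]
        rw [hr'] at hr
        exact hr.sublist ((sublist_of_mem_picks hpb).map _))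
    refine ⟨u, hu, ?_⟩
    have : (1 - 4 * kappa) * s'.cost ≤ (1 - 4 * kappa) * s.cost :=
      mul_le_mul_of_nonneg_left hc' (by linarith)
    linarith

/-! ## Optimal solutions cross the median -/

/-- The cost of a multiset of triples of a weight and two positions. -/
noncomputable def pairCost {ι : Type*} (s : ι → ℝ) (T : Multiset (ℝ × ι × ι)) : ℝ :=
  (T.map fun t => t.1 / |s t.2.1 - s t.2.2|).sum

theorem pairCost_cons {ι : Type*} (s : ι → ℝ) (t : ℝ × ι × ι) (T : Multiset (ℝ × ι × ι)) :
    pairCost s (t ::ₘ T) = t.1 / |s t.2.1 - s t.2.2| + pairCost s T := by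
  simp [pairCost]

theorem exists_exchange {ι : Type*} {s : ι → ℝ} {p q r u : ι} {z w : ℝ} (hz : 0 ≤ z) (hw : 0 ≤ w)
    (hpq : 0 < |s p - s q|) (hru : 0 < |s r - s u|) (h1 : s r < s p) (h2 : s u < s p)
    (h3 : s r < s q) (h4 : s u < s q) :
    ∃ p' q' r' u', ({p', q'} : Multiset ι) = {p, q} ∧ ({r', u'} : Multiset ι) = {r, u} ∧
      z / |s p' - s r'| + w / |s q' - s u'| ≤ z / |s p - s q| + w / |s r - s u| := by
  wlog hp : s q ≤ s p generalizing p q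
  · obtain ⟨p', q', r', u', e1, e2, e3⟩ := this (p := q) (q := p) (by rwa [abs_sub_comm])
      h3 h4 h1 h2 (le_of_not_ge hp)
    exact ⟨p', q', r', u', e1.trans (Multiset.pair_comm _ _), e2, by
      rwa [abs_sub_comm (s p) (s q)]⟩
  wlog hr : s u ≤ s r generalizing r u
  · obtain ⟨p', q', r', u', e1, e2, e3⟩ := this (r := u) (u := r) (by rwa [abs_sub_comm])
      h2 h1 h4 h3 (le_of_not_ge hr)
    exact ⟨p', q', r', u', e1, e2.trans (Multiset.pair_comm _ _), by
      rwa [abs_sub_comm (s r) (s u)]⟩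
  refine ⟨p, q, r, u, rfl, rfl, ?_⟩
  rw [abs_of_nonneg (sub_nonneg.2 hp)] at hpq ⊢
  rw [abs_of_nonneg (sub_nonneg.2 hr)] at hru ⊢
  rw [abs_of_pos (sub_pos.2 h1), abs_of_pos (sub_pos.2 h4)]
  gcongr

theorem exists_crossing {ι : Type*} {s : ι → ℝ} {P : ι → Prop} [DecidablePred P]
    (hP : ∀ i j, P i → ¬ P j → s j < s i) (T : Multiset (ℝ × ι × ι))
    (hT : ∀ t ∈ T, 0 ≤ t.1 ∧ 0 < |s t.2.1 - s t.2.2|)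
    (hcard : ((T.map (·.2.1) + T.map (·.2.2)).filter P).card =
      ((T.map (·.2.1) + T.map (·.2.2)).filter fun i => ¬ P i).card) :
    ∃ T' : Multiset (ℝ × ι × ι), T'.map (·.1) = T.map (·.1) ∧
      T'.map (·.2.1) = (T.map (·.2.1) + T.map (·.2.2)).filter P ∧
      T'.map (·.2.2) = ((T.map (·.2.1) + T.map (·.2.2)).filter fun i => ¬ P i) ∧
      pairCost s T' ≤ pairCost s T := by
  induction hn : T.card using Nat.strong_induction_on generalizing T with
  | _ n ih =>
  by_cases hmix : ∃ t ∈ T, ¬ (P t.2.1 ↔ P t.2.2)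
  · obtain ⟨⟨z, p, q⟩, ht, hpq⟩ := hmix
    obtain ⟨T₁, rfl⟩ := Multiset.exists_cons_of_mem ht
    dsimp only at hpq
    have hsum : Multiset.map (·.2.1) ((z, p, q) ::ₘ T₁) + Multiset.map (·.2.2) ((z, p, q) ::ₘ T₁) =
        p ::ₘ q ::ₘ (T₁.map (·.2.1) + T₁.map (·.2.2)) := by
      simp [Multiset.cons_swap]
    rw [hsum] at hcard ⊢
    have hT₁ := fun t h => hT t (Multiset.mem_cons_of_mem h)
    rw [Multiset.card_cons] at hn
    by_cases hp : P p
    · have hq : ¬ P q := fun hq => hpq ⟨fun _ => hq, fun _ => hp⟩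
      rw [Multiset.filter_cons_of_pos _ hp, Multiset.filter_cons_of_neg _ hq,
        Multiset.filter_cons_of_neg (p := fun i => ¬ P i) _ (not_not.2 hp),
        Multiset.filter_cons_of_pos (p := fun i => ¬ P i) _ hq] at hcard ⊢
      rw [Multiset.card_cons, Multiset.card_cons, Nat.add_right_cancel_iff] at hcard
      obtain ⟨T', h1, h2, h3, h4⟩ := ih _ (by omega) T₁ hT₁ hcard rfl
      exact ⟨(z, p, q) ::ₘ T', by simp [h1], by simp [h2], by simp [h3], by
        simp only [pairCost_cons]; linarith⟩
    · have hq : P q := by tauto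
      rw [Multiset.filter_cons_of_neg _ hp, Multiset.filter_cons_of_pos _ hq,
        Multiset.filter_cons_of_pos (p := fun i => ¬ P i) _ hp,
        Multiset.filter_cons_of_neg (p := fun i => ¬ P i) _ (not_not.2 hq)] at hcard ⊢
      rw [Multiset.card_cons, Multiset.card_cons, Nat.add_right_cancel_iff] at hcard
      obtain ⟨T', h1, h2, h3, h4⟩ := ih _ (by omega) T₁ hT₁ hcard rfl
      exact ⟨(z, q, p) ::ₘ T', by simp [h1], by simp [h2], by simp [h3], by
        simp only [pairCost_cons]; rw [abs_sub_comm (s q)]; linarith⟩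
  · simp only [not_exists, not_and, not_not] at hmix
    rcases T.empty_or_exists_mem with rfl | ⟨t₀, ht₀⟩
    · exact ⟨0, by simp⟩
    have hex : (∃ t ∈ T, P t.2.1) ∧ ∃ t ∈ T, ¬ P t.2.1 := by
      constructor
      · by_contra! hno
        have : (T.map (·.2.1) + T.map (·.2.2)).filter P = 0 := by
          rw [Multiset.filter_eq_nil]
          intro i hi
          rcases Multiset.mem_add.1 hi with hi | hi
          · obtain ⟨t, ht, rfl⟩ := Multiset.mem_map.1 hi
            exact hno t ht
          · obtain ⟨t, ht, rfl⟩ := Multiset.mem_map.1 hi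
            exact mt (hmix t ht).2 (hno t ht)
        rw [this, Multiset.card_zero, eq_comm, Multiset.card_eq_zero, Multiset.filter_eq_nil] at hcard
        exact hcard t₀.2.1 (Multiset.mem_add.2 (.inl (Multiset.mem_map_of_mem (·.2.1) ht₀)))
          (hno t₀ ht₀)
      · by_contra! hno
        have : (T.map (·.2.1) + T.map (·.2.2)).filter (fun i => ¬ P i) = 0 := by
          rw [Multiset.filter_eq_nil]
          intro i hi
          rw [not_not]
          rcases Multiset.mem_add.1 hi with hi | hi
          · obtain ⟨t, ht, rfl⟩ := Multiset.mem_map.1 hi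
            exact hno t ht
          · obtain ⟨t, ht, rfl⟩ := Multiset.mem_map.1 hi
            exact (hmix t ht).1 (hno t ht)
        rw [this, Multiset.card_zero, Multiset.card_eq_zero, Multiset.filter_eq_nil] at hcard
        exact hcard t₀.2.1 (Multiset.mem_add.2 (.inl (Multiset.mem_map_of_mem (·.2.1) ht₀)))
          (hno t₀ ht₀)
    obtain ⟨⟨⟨z, p, q⟩, ht, hp⟩, ⟨w, r, u⟩, ht', hr⟩ := hex
    have hq := (hmix _ ht).1 hp
    have hu := mt (hmix _ ht').2 hr
    obtain ⟨T₁, rfl⟩ := Multiset.exists_cons_of_mem ht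
    have ht₁ : (w, r, u) ∈ T₁ := by
      refine (Multiset.mem_cons.1 ht').resolve_left fun h => ?_
      cases h
      exact hr hp
    obtain ⟨T₂, rfl⟩ := Multiset.exists_cons_of_mem ht₁
    dsimp only at hp hq hr hu
    have hsum : Multiset.map (·.2.1) ((z, p, q) ::ₘ (w, r, u) ::ₘ T₂) +
        Multiset.map (·.2.2) ((z, p, q) ::ₘ (w, r, u) ::ₘ T₂) =
        ({p, q} + {r, u}) + (T₂.map (·.2.1) + T₂.map (·.2.2)) := by
      simp only [← Multiset.singleton_add, Multiset.insert_eq_cons, Multiset.map_add,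
        Multiset.map_singleton]
      abel
    have f1 : ({p, q} + {r, u} : Multiset ι).filter P = {p, q} := by
      simp [Multiset.insert_eq_cons, hp, hq, hr, hu, Multiset.filter_singleton,
        ← Multiset.singleton_add]
    have f2 : (({p, q} + {r, u} : Multiset ι).filter fun i => ¬ P i) = {r, u} := by
      simp [Multiset.insert_eq_cons, hp, hq, hr, hu, Multiset.filter_singleton,
        ← Multiset.singleton_add]
    rw [hsum, Multiset.filter_add, Multiset.filter_add _ (_ + _), f1, f2] at hcard ⊢
    simp only [Multiset.card_add, Multiset.card_pair, Nat.add_left_cancel_iff] at hcard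
    simp only [Multiset.card_cons] at hn
    obtain ⟨T', h1, h2, h3, h4⟩ := ih _ (by omega) T₂
      (fun t h => hT t (by simp [h])) (by simpa using hcard) rfl
    have g1 := hT _ ht
    have g2 := hT _ ht'
    obtain ⟨p', q', r', u', e1, e2, e3⟩ := exists_exchange g1.1 g2.1 g1.2 g2.2
      (hP p r hp hr) (hP p u hp hu) (hP q r hq hr) (hP q u hq hu)
    dsimp only at e3
    refine ⟨(z, p', r') ::ₘ (w, q', u') ::ₘ T', by simp [h1], ?_, ?_, ?_⟩
    · simp only [← e1, Multiset.insert_eq_cons, ← Multiset.singleton_add, Multiset.map_add,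
        Multiset.map_singleton, h2]
      abel
    · simp only [← e2, Multiset.insert_eq_cons, ← Multiset.singleton_add, Multiset.map_add,
        Multiset.map_singleton, h3]
      abel
    · simp only [pairCost_cons]; linarith

/-! ## Rounding -/

theorem map_snd_roundList (m lam r : ℝ) (l acc : List (ℝ × α)) :
    (roundList m lam r l acc).map Prod.snd = (l.map Prod.snd).reverse ++ acc.map Prod.snd := by
  induction l generalizing r acc with
  | nil => simp [roundList]
  | cons e l ih =>
    rw [roundList]
    split_ifs <;> simp [ih]

theorem mem_roundList {m lam r : ℝ} {l acc : List (ℝ × α)} (hr : 0 ≤ r) (hlam : 1 ≤ lam)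
    (hl : l.Pairwise fun x y => |x.1 - m| ≤ |y.1 - m|) (hrl : ∀ x ∈ l, r ≤ |x.1 - m|)
    {e : ℝ × α} (he : e ∈ roundList m lam r l acc) :
    e ∈ acc ∨ ∃ x ∈ l, e.2 = x.2 ∧ 0 ≤ e.1 ∧ e.1 ≤ |x.1 - m| ∧ |x.1 - m| ≤ lam * e.1 := by
  induction l generalizing r acc with
  | nil => exact .inl he
  | cons x l ih =>
    rw [List.pairwise_cons] at hl
    rw [List.forall_mem_cons] at hrl
    rw [roundList] at he
    split_ifs at he with h
    · rcases ih hr hl.2 hrl.2 he with he | ⟨y, hy, hy'⟩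
      · rcases List.mem_cons.1 he with rfl | he
        · exact .inr ⟨x, by simp, rfl, hr, hrl.1, h⟩
        · exact .inl he
      · exact .inr ⟨y, List.mem_cons_of_mem _ hy, hy'⟩
    · rcases ih (abs_nonneg _) hl.2 hl.1 he with he | ⟨y, hy, hy'⟩
      · rcases List.mem_cons.1 he with rfl | he
        · exact .inr ⟨x, by simp, rfl, abs_nonneg _, le_rfl,
            le_mul_of_one_le_left (abs_nonneg _) hlam⟩
        · exact .inl he
      · exact .inr ⟨y, List.mem_cons_of_mem _ hy, hy'⟩

theorem separated_roundList {m lam r : ℝ} {l acc : List (ℝ × α)} (hlam : 1 ≤ lam)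
    (hl : l.Pairwise fun x y => |x.1 - m| ≤ |y.1 - m|) (hrl : ∀ x ∈ l, r ≤ |x.1 - m|)
    (hacc : Separated lam acc) (haccr : ∀ x ∈ acc, x.1 ≤ r ∧ (x.1 = r ∨ lam * x.1 < r)) :
    Separated lam (roundList m lam r l acc) := by
  induction l generalizing r acc with
  | nil => exact hacc
  | cons x l ih =>
    rw [List.pairwise_cons] at hl
    rw [List.forall_mem_cons] at hrl
    rw [roundList]
    split_ifs with h
    · refine ih hl.2 hrl.2 (List.pairwise_cons.2 ⟨haccr, hacc⟩) ?_
      rw [List.forall_mem_cons]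
      exact ⟨⟨le_rfl, .inl rfl⟩, haccr⟩
    · have key : ∀ y ∈ acc, y.1 ≤ |x.1 - m| ∧ (y.1 = |x.1 - m| ∨ lam * y.1 < |x.1 - m|) :=
        fun y hy => ⟨(haccr y hy).1.trans hrl.1, .inr ((mul_le_mul_of_nonneg_left (haccr y hy).1
          (by linarith)).trans_lt (not_le.1 h))⟩
      refine ih hl.2 hl.1 (List.pairwise_cons.2 ⟨key, hacc⟩) ?_
      rw [List.forall_mem_cons]
      exact ⟨⟨le_rfl, .inl rfl⟩, key⟩

/-! ## The solutions in the states -/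

/-- The state `st` describes a partial solution with the positions `s` and the weights `z`, for the
elements in `A` and `B`, and it remains to serve the targets in `zts`. -/
structure SearchState.Sound (s : α → ℝ) (z : β → ℝ) (A B : List α) (K : List β)
    (zts : List (ℝ × β)) (st : SearchState α β) : Prop where
  left_perm : (st.out.map (·.2.1) ++ st.left.map Prod.snd).Perm A
  right_perm : (st.out.map (·.2.2) ++ st.right.map Prod.snd).Perm B
  targets_perm : (st.out.map (·.1) ++ zts.map Prod.snd).Perm K
  length_left : st.left.length = zts.length
  length_right : st.right.length = zts.length
  weight : ∀ e ∈ zts, e.1 = z e.2 ∧ 0 ≤ e.1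
  key_pos : ∀ x ∈ st.left, ∀ y ∈ st.right, 0 < x.1 + y.1 ∧ x.1 + y.1 ≤ |s x.2 - s y.2|
  cost_ge : (st.out.map fun x => z x.1 / |s x.2.1 - s x.2.2|).sum ≤ st.cost

theorem perm_append_of_mem_picks {tau : ℝ} {l : List (ℝ × α)} {p : (ℝ × α) × List (ℝ × α)}
    (hp : p ∈ picks tau l) (L : List α) :
    (p.1.2 :: L ++ p.2.map Prod.snd).Perm (L ++ l.map Prod.snd) := by
  obtain ⟨l₁, l₂, rfl, h, -⟩ := mem_picks_iff.1 hp
  rw [h]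
  simp only [List.map_append, List.map_cons, List.cons_append]
  rw [← List.append_assoc, ← List.append_assoc]
  exact List.perm_middle.symm

theorem SearchState.Sound.expand {s : α → ℝ} {z : β → ℝ} {A B : List α} {K : List β}
    {zt : ℝ × β} {zts : List (ℝ × β)} {st s' : SearchState α β} {kappa : ℝ}
    (h : st.Sound s z A B K (zt :: zts)) (hs : s' ∈ st.expand kappa zt) :
    s'.Sound s z A B K zts := by
  obtain ⟨x, l, y, r, hl, hr, pa, hpa, pb, hpb, rfl⟩ := SearchState.mem_expand_iff.1 hs
  have e1 := length_snd_of_mem_picks hpa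
  have e2 := length_snd_of_mem_picks hpb
  rw [← hl] at hpa e1
  rw [← hr] at hpb e2
  have g1 := h.length_left
  have g2 := h.length_right
  rw [List.length_cons] at g1 g2
  refine ⟨?_, ?_, ?_, ?_, ?_, fun e he => h.weight e (List.mem_cons_of_mem _ he), ?_, ?_⟩
  · exact (perm_append_of_mem_picks hpa _).trans h.left_perm
  · exact (perm_append_of_mem_picks hpb _).trans h.right_perm
  · exact List.perm_middle.symm.trans h.targets_perm
  · simp only [SearchState.next]; omega
  · simp only [SearchState.next]; omega
  · exact fun u hu v hv => h.key_pos u ((sublist_of_mem_picks hpa).subset hu) v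
      ((sublist_of_mem_picks hpb).subset hv)
  · have hw := h.weight zt (by simp)
    have hk := h.key_pos _ (fst_mem_of_mem_picks hpa) _ (fst_mem_of_mem_picks hpb)
    simp only [SearchState.next, List.map_cons, List.sum_cons]
    rw [add_comm]
    refine add_le_add h.cost_ge ?_
    rw [← hw.1]
    exact div_le_div_of_nonneg_left hw.2 hk.1 hk.2

theorem sound_of_mem_search {s : α → ℝ} {z : β → ℝ} {A B : List α} {K : List β}
    {zts : List (ℝ × β)} {sts : List (SearchState α β)} {kappa : ℝ}
    (h : ∀ st ∈ sts, st.Sound s z A B K zts) :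
    ∀ st ∈ search kappa zts sts, st.Sound s z A B K [] := by
  induction zts generalizing sts with
  | nil => exact h
  | cons zt zts ih =>
    exact ih (forall_mem_expandStates fun st hst s' hs' => (h st hst).expand hs')

theorem exists_search_eq_singleton {s : α → ℝ} {z : β → ℝ} {A B : List α} {K : List β}
    {zts : List (ℝ × β)} {sts : List (SearchState α β)} {kappa : ℝ}
    (h : ∀ st ∈ sts, st.Sound s z A B K zts) (hne : search kappa zts sts ≠ []) (hzts : zts ≠ []) :
    ∃ st, search kappa zts sts = [st] := by
  have hsound := sound_of_mem_search (kappa := kappa) h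
  have hnodup : ((search kappa zts sts).map SearchState.keys).Nodup := by
    obtain ⟨l, zt, rfl⟩ := (List.eq_nil_or_concat' zts).resolve_left hzts
    rw [search, List.foldl_append]
    exact nodup_keys_expandStates _ _ _
  have hkeys : ∀ st ∈ search kappa zts sts, st.keys = ([], []) := fun st hst => by
    have h1 := (hsound st hst).length_left
    have h2 := (hsound st hst).length_right
    rw [List.length_nil, List.length_eq_zero_iff] at h1 h2
    rw [SearchState.keys, h1, h2]
    rfl
  match hL : search kappa zts sts with
  | [] => exact absurd hL hne
  | [st] => exact ⟨st, rfl⟩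
  | st :: st' :: l =>
    rw [hL] at hkeys hnodup
    rw [List.map_cons, List.map_cons, hkeys st (by simp), hkeys st' (by simp)] at hnodup
    simp at hnodup

theorem exists_key_function {l : List (ℝ × α)} (h : (l.map Prod.snd).Nodup) :
    ∃ v : α → ℝ, ∀ e ∈ l, e.1 = v e.2 := by
  classical
  refine ⟨fun i => if hi : ∃ e ∈ l, e.2 = i then hi.choose.1 else 0, fun e he => ?_⟩
  have hi : ∃ f ∈ l, f.2 = e.2 := ⟨e, he, rfl⟩
  dsimp only
  rw [dif_pos hi]
  exact congrArg Prod.fst (List.inj_on_of_nodup_map h he hi.choose_spec.1 hi.choose_spec.2.symm)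

/-! ## Solutions -/

theorem exists_assignment {n : ℕ} {out : List (Fin n × Fin (2 * n) × Fin (2 * n))}
    (h1 : (out.map (·.1)).Perm (List.finRange n))
    (h2 : (out.map (·.2.1) ++ out.map (·.2.2)).Perm (List.finRange (2 * n))) :
    ∃ A : CameraAssignment n, out.Perm (List.ofFn fun k => (k, A.fst k, A.snd k)) := by
  classical
  have hnd : (out.map (·.1)).Nodup := h1.nodup_iff.2 (List.nodup_finRange n)
  have hex : ∀ k : Fin n, ∃ x ∈ out, x.1 = k := fun k =>
    List.mem_map.1 (h1.mem_iff.2 (List.mem_finRange k))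
  choose f hf hf' using hex
  have hperm : out.Perm ((List.finRange n).map f) := by
    have : out.map id = (out.map (·.1)).map f := by
      rw [List.map_map]
      exact List.map_congr_left fun x hx =>
        List.inj_on_of_nodup_map hnd hx (hf x.1) (hf' x.1).symm
    rw [List.map_id] at this
    conv_lhs => rw [this]
    exact h1.map f
  have hinj : Function.Injective (Sum.elim (fun k => (f k).2.1) fun k => (f k).2.2) := by
    have hnd2 : (((List.finRange n).map fun k => (f k).2.1) ++
        (List.finRange n).map fun k => (f k).2.2).Nodup := by
      have e := (List.Perm.append (hperm.map (·.2.1)) (hperm.map (·.2.2))).symm.trans h2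
      rw [List.map_map, List.map_map] at e
      exact e.nodup_iff.2 (List.nodup_finRange _)
    rw [List.nodup_append] at hnd2
    obtain ⟨n1, n2, n3⟩ := hnd2
    rintro (a | a) (b | b) hab
    · exact congrArg _ (List.inj_on_of_nodup_map n1 (List.mem_finRange a) (List.mem_finRange b) hab)
    · exact absurd hab (n3 _ (List.mem_map_of_mem (List.mem_finRange a)) _
        (List.mem_map_of_mem (List.mem_finRange b)))
    · exact absurd hab.symm (n3 _ (List.mem_map_of_mem (List.mem_finRange b)) _
        (List.mem_map_of_mem (List.mem_finRange a)))
    · exact congrArg _ (List.inj_on_of_nodup_map n2 (List.mem_finRange a) (List.mem_finRange b) hab)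
  refine ⟨⟨fun k => (f k).2.1, fun k => (f k).2.2,
    (Fintype.bijective_iff_injective_and_card _).2 ⟨hinj, by simp [two_mul]⟩⟩, ?_⟩
  rw [List.ofFn_eq_map]
  convert hperm using 2
  funext k
  exact Prod.ext (hf' k).symm rfl

theorem map_fst_add_map_snd {n : ℕ} (B : CameraAssignment n) :
    (Finset.univ : Finset (Fin n)).val.map B.fst + (Finset.univ : Finset (Fin n)).val.map B.snd =
      (Finset.univ : Finset (Fin (2 * n))).val := by
  have hi := B.bijective.1
  have h1 : Function.Injective B.fst := fun a b h => Sum.inl_injective (hi h)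
  have h2 : Function.Injective B.snd := fun a b h => Sum.inr_injective (hi h)
  refine (Multiset.Nodup.ext ?_ Finset.univ.nodup).2 fun i => ?_
  · refine (Multiset.nodup_add ..).2 ⟨Finset.univ.nodup.map h1, Finset.univ.nodup.map h2, ?_⟩
    rw [Multiset.disjoint_left]
    intro i hi1 hi2
    obtain ⟨a, -, ha⟩ := Multiset.mem_map.1 hi1
    obtain ⟨b, -, hb⟩ := Multiset.mem_map.1 hi2
    have : (Sum.inl a : Fin n ⊕ Fin n) = Sum.inr b := hi (by simp [ha, hb])
    simp at this
  · simp only [Finset.mem_val, Finset.mem_univ, iff_true]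
    obtain ⟨a | a, ha⟩ := B.bijective.2 i
    · exact Multiset.mem_add.2 (.inl (Multiset.mem_map.2 ⟨a, by simp, ha⟩))
    · exact Multiset.mem_add.2 (.inr (Multiset.mem_map.2 ⟨a, by simp, ha⟩))

theorem nonempty_cameraAssignment (n : ℕ) : Nonempty (CameraAssignment n) := by
  let e : Fin n ⊕ Fin n ≃ Fin (2 * n) := finSumFinEquiv.trans (finCongr (two_mul n).symm)
  refine ⟨⟨fun k => e (.inl k), fun k => e (.inr k), ?_⟩⟩
  convert e.bijective
  funext x
  cases x <;> rfl

/-! ## The approximation guarantee -/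

/-- The first half of a sorted list of cameras, in ascending order, and the second half. -/
structure Halves {n : ℕ} (s : Fin (2 * n) → ℝ) (m : ℝ) (hi lo : List (ℝ × Fin (2 * n))) : Prop where
  hi_fst : ∀ x ∈ hi, x.1 = s x.2
  lo_fst : ∀ x ∈ lo, x.1 = s x.2
  mem_hi : ∀ i, i ∈ hi.map Prod.snd ↔ m ≤ s i
  mem_lo : ∀ i, i ∈ lo.map Prod.snd ↔ ¬ m ≤ s i
  hi_nodup : (hi.map Prod.snd).Nodup
  lo_nodup : (lo.map Prod.snd).Nodup
  hi_length : hi.length = n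
  lo_length : lo.length = n
  hi_pairwise : hi.Pairwise fun x y => |x.1 - m| ≤ |y.1 - m|
  lo_pairwise : lo.Pairwise fun x y => |x.1 - m| ≤ |y.1 - m|

theorem exists_halves {n : ℕ} (hn : 0 < n) {s : Fin (2 * n) → ℝ} (hs : Function.Injective s)
    {cams hi lo : List (ℝ × Fin (2 * n))}
    (hcams : cams = ((List.finRange (2 * n)).map fun i => (s i, i)).insertionSort KeyGE)
    (hhi : hi = (cams.take n).reverse) (hlo : lo = cams.drop n) :
    ∃ e hi', hi = e :: hi' ∧ Halves s e.1 hi lo := by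
  have hperm : cams.Perm ((List.finRange (2 * n)).map fun i => (s i, i)) := by
    rw [hcams]; exact List.perm_insertionSort _ _
  have hfst : ∀ x ∈ cams, x.1 = s x.2 := by
    intro x hx
    obtain ⟨i, -, rfl⟩ := List.mem_map.1 (hperm.mem_iff.1 hx)
    rfl
  have hsnd : (cams.map Prod.snd).Perm (List.finRange (2 * n)) := by
    have := hperm.map Prod.snd
    rwa [List.map_map, show Prod.snd ∘ (fun i => (s i, i)) = id from rfl, List.map_id] at this
  have hnd : (cams.map Prod.snd).Nodup := hsnd.nodup_iff.2 (List.nodup_finRange _)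
  have hlen : cams.length = 2 * n := by simpa using hperm.length_eq
  have hsort : cams.Pairwise KeyGE := by rw [hcams]; exact List.pairwise_insertionSort _ _
  have hlt : cams.Pairwise fun x y => y.1 < x.1 := by
    refine (hsort.and (List.pairwise_map.1 hnd)).imp_of_mem fun {x y} hx hy h => ?_
    refine lt_of_le_of_ne h.1 fun heq => h.2 (hs ?_)
    rw [← hfst x hx, ← hfst y hy, heq]
  have hsplit : hi.reverse ++ lo = cams := by
    rw [hhi, hlo, List.reverse_reverse, List.take_append_drop]
  rw [← hsplit] at hlt hnd hfst hsnd
  rw [List.pairwise_append] at hlt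
  obtain ⟨hlt1, hlt2, hlt3⟩ := hlt
  rw [List.pairwise_reverse] at hlt1
  rw [List.map_append, List.nodup_append] at hnd
  have hhilen : hi.length = n := by rw [hhi, List.length_reverse, List.length_take]; omega
  obtain ⟨e, hi', rfl⟩ := List.exists_cons_of_ne_nil (l := hi) (by rintro rfl; simp at hhilen; omega)
  have hmin : ∀ x ∈ e :: hi', e.1 ≤ x.1 := by
    intro x hx
    rcases List.mem_cons.1 hx with rfl | hx
    · exact le_rfl
    · exact ((List.pairwise_cons.1 hlt1).1 x hx).le
  have hmax : ∀ y ∈ lo, y.1 < e.1 := fun y hy => hlt3 e (by simp) y hy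
  have hfhi : ∀ x ∈ e :: hi', x.1 = s x.2 := fun x hx =>
    hfst x (List.mem_append.2 (.inl (List.mem_reverse.2 hx)))
  have hflo : ∀ x ∈ lo, x.1 = s x.2 := fun x hx => hfst x (List.mem_append.2 (.inr hx))
  have h1 : ∀ i, i ∈ (e :: hi').map Prod.snd → e.1 ≤ s i := by
    intro i hi
    obtain ⟨x, hx, rfl⟩ := List.mem_map.1 hi
    rw [← hfhi x hx]
    exact hmin x hx
  have h2 : ∀ i, i ∈ lo.map Prod.snd → s i < e.1 := by
    intro i hi
    obtain ⟨x, hx, rfl⟩ := List.mem_map.1 hi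
    rw [← hflo x hx]
    exact hmax x hx
  have h3 : ∀ i, i ∈ (e :: hi').map Prod.snd ∨ i ∈ lo.map Prod.snd := by
    intro i
    have := hsnd.mem_iff.2 (List.mem_finRange i)
    rwa [List.map_append, List.mem_append, List.map_reverse, List.mem_reverse] at this
  refine ⟨e, hi', rfl, hfhi, hflo, fun i => ⟨h1 i, fun h => (h3 i).resolve_right fun h' =>
      (h2 i h').not_ge h⟩, fun i => ⟨fun h => (h2 i h).not_ge, fun h => (h3 i).resolve_left
      fun h' => h (h1 i h')⟩, ?_, hnd.2.1, hhilen, ?_, ?_, ?_⟩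
  · have := hnd.1
    rwa [List.map_reverse, List.nodup_reverse] at this
  · rw [hlo, List.length_drop]; omega
  · refine hlt1.imp_of_mem fun {x y} hx hy h => ?_
    rw [abs_of_nonneg (sub_nonneg.2 (hmin x hx)), abs_of_nonneg (sub_nonneg.2 (hmin y hy))]
    linarith
  · refine hlt2.imp_of_mem fun {x y} hx hy h => ?_
    rw [abs_of_neg (sub_neg.2 (hmax x hx)), abs_of_neg (sub_neg.2 (hmax y hy))]
    linarith

/-- The properties of the result of rounding the distances of the cameras in `l` to `m`. -/
structure RoundingOf {n : ℕ} (s : Fin (2 * n) → ℝ) (m lam : ℝ) (l a : List (ℝ × Fin (2 * n))) :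
    Prop where
  map_snd : a.map Prod.snd = (l.map Prod.snd).reverse
  separated : Separated lam a
  nonneg : ∀ x ∈ a, 0 ≤ x.1
  le : ∀ x ∈ a, x.1 ≤ |s x.2 - m|
  ge : ∀ x ∈ a, |s x.2 - m| ≤ lam * x.1

theorem RoundingOf.length_eq {n : ℕ} {s : Fin (2 * n) → ℝ} {m lam : ℝ}
    {l a : List (ℝ × Fin (2 * n))} (h : RoundingOf s m lam l a) : a.length = l.length := by
  simpa using congrArg List.length h.map_snd

theorem roundingOf {n : ℕ} {s : Fin (2 * n) → ℝ} {m lam : ℝ} {l : List (ℝ × Fin (2 * n))}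
    (hlam : 1 ≤ lam) (hl : l.Pairwise fun x y => |x.1 - m| ≤ |y.1 - m|)
    (hfst : ∀ x ∈ l, x.1 = s x.2) : RoundingOf s m lam l (roundList m lam 0 l []) := by
  have key : ∀ x ∈ roundList m lam 0 l [], 0 ≤ x.1 ∧ x.1 ≤ |s x.2 - m| ∧
      |s x.2 - m| ≤ lam * x.1 := by
    intro x hx
    rcases mem_roundList le_rfl hlam hl (fun x _ => abs_nonneg _) hx with h | ⟨y, hy, h⟩
    · simp at h
    · rw [h.1, ← hfst y hy]
      exact h.2
  exact ⟨by rw [map_snd_roundList]; simp,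
    separated_roundList hlam hl (fun x _ => abs_nonneg _) List.Pairwise.nil (by simp),
    fun x hx => (key x hx).1, fun x hx => (key x hx).2.1, fun x hx => (key x hx).2.2⟩

theorem exists_isMatching {n : ℕ} {s : Fin (2 * n) → ℝ} (hs : Function.Injective s)
    {z : Fin n → ℝ} (hz : ∀ k, 0 ≤ z k) {m lam : ℝ} (hlam : 0 < lam)
    {hi lo a b : List (ℝ × Fin (2 * n))}
    (hh : Halves s m hi lo) (ha : RoundingOf s m lam hi a) (hb : RoundingOf s m lam lo b)
    (hbpos : ∀ y ∈ b, 0 < y.1) {zts : List (ℝ × Fin n)}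
    (hzts : zts.Perm ((List.finRange n).map fun k => (z k, k))) (B : CameraAssignment n) :
    ∃ T, IsMatching (keysOf zts) (keysOf a) (keysOf b) T ∧
      matchCost T ≤ lam * ∑ k, z k / |s (B.fst k) - s (B.snd k)| := by
  classical
  obtain ⟨va, hva⟩ := exists_key_function (l := a)
    (by rw [ha.map_snd, List.nodup_reverse]; exact hh.hi_nodup)
  obtain ⟨vb, hvb⟩ := exists_key_function (l := b)
    (by rw [hb.map_snd, List.nodup_reverse]; exact hh.lo_nodup)
  set U : Multiset (ℝ × Fin (2 * n) × Fin (2 * n)) :=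
    (Finset.univ : Finset (Fin n)).val.map fun k => (z k, B.fst k, B.snd k) with hU
  have hU1 : U.map (·.1) = (Finset.univ : Finset (Fin n)).val.map z := by
    rw [hU, Multiset.map_map]; rfl
  have hU2 : U.map (·.2.1) + U.map (·.2.2) = (Finset.univ : Finset (Fin (2 * n))).val := by
    rw [hU, Multiset.map_map, Multiset.map_map]
    exact map_fst_add_map_snd B
  have hUc : pairCost s U = ∑ k, z k / |s (B.fst k) - s (B.snd k)| := by
    rw [hU, pairCost, Multiset.map_map]; rfl
  have hP1 : (Finset.univ : Finset (Fin (2 * n))).val.filter (fun i => m ≤ s i) =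
      (hi.map Prod.snd : List _) := by
    refine (Multiset.Nodup.ext (Finset.univ.nodup.filter _) (Multiset.coe_nodup.2 hh.hi_nodup)).2 fun i => ?_
    rw [Multiset.mem_filter, Multiset.mem_coe, hh.mem_hi]
    simp
  have hP2 : (Finset.univ : Finset (Fin (2 * n))).val.filter (fun i => ¬ m ≤ s i) =
      (lo.map Prod.snd : List _) := by
    refine (Multiset.Nodup.ext (Finset.univ.nodup.filter _) (Multiset.coe_nodup.2 hh.lo_nodup)).2 fun i => ?_
    rw [Multiset.mem_filter, Multiset.mem_coe, hh.mem_lo]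
    simp
  obtain ⟨T, h1, h2, h3, h4⟩ := exists_crossing (s := s) (P := fun i => m ≤ s i)
    (fun i j hi hj => (not_le.1 hj).trans_le hi) U
    (fun t ht => by
      obtain ⟨k, -, rfl⟩ := Multiset.mem_map.1 ht
      refine ⟨hz k, abs_pos.2 (sub_ne_zero.2 fun h => ?_)⟩
      have := B.bijective.1 (a₁ := .inl k) (a₂ := .inr k) (hs h)
      simp at this)
    (by rw [hU2, hP1, hP2]; simp [hh.hi_length, hh.lo_length])
  rw [hU2, hP1] at h2
  rw [hU2, hP2] at h3
  have hka : keysOf a = Multiset.map va (hi.map Prod.snd : List _) := by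
    rw [← Multiset.coe_reverse, ← ha.map_snd, keysOf, Multiset.map_coe, List.map_map]
    exact congrArg _ (List.map_congr_left hva)
  have hkb : keysOf b = Multiset.map vb (lo.map Prod.snd : List _) := by
    rw [← Multiset.coe_reverse, ← hb.map_snd, keysOf, Multiset.map_coe, List.map_map]
    exact congrArg _ (List.map_congr_left hvb)
  have hkz : keysOf zts = (Finset.univ : Finset (Fin n)).val.map z := by
    have : (zts : Multiset (ℝ × Fin n)) = (List.finRange n).map fun k => (z k, k) :=
      Multiset.coe_eq_coe.2 hzts
    rw [keysOf, ← Multiset.map_coe, this, Multiset.map_coe, List.map_map, ← Multiset.map_coe]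
    rfl
  refine ⟨T.map fun t => (t.1, va t.2.1, vb t.2.2), ⟨?_, ?_, ?_, ?_, ?_, ?_⟩, ?_⟩
  · rw [hkz, ← hU1, ← h1, Multiset.map_map]; rfl
  · rw [hka, ← h2, Multiset.map_map, Multiset.map_map]; rfl
  · rw [hkb, ← h3, Multiset.map_map, Multiset.map_map]; rfl
  · intro x hx
    rw [hkz] at hx
    obtain ⟨k, -, rfl⟩ := Multiset.mem_map.1 hx
    exact hz k
  · intro x hx
    obtain ⟨e, he, rfl⟩ := List.mem_map.1 (Multiset.mem_coe.1 hx)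
    exact ha.nonneg e he
  · intro x hx
    obtain ⟨e, he, rfl⟩ := List.mem_map.1 (Multiset.mem_coe.1 hx)
    exact hbpos e he
  · rw [← hUc]
    refine le_trans ?_ (mul_le_mul_of_nonneg_left h4 hlam.le)
    rw [matchCost, pairCost, Multiset.map_map, ← Multiset.sum_map_mul_left]
    refine Multiset.sum_map_le_sum_map _ _ fun t ht => ?_
    have ht1 : t.2.1 ∈ hi.map Prod.snd := by
      rw [← Multiset.mem_coe, ← h2]; exact Multiset.mem_map_of_mem (fun t : ℝ × _ × _ => t.2.1) ht
    have ht2 : t.2.2 ∈ lo.map Prod.snd := by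
      rw [← Multiset.mem_coe, ← h3]; exact Multiset.mem_map_of_mem (fun t : ℝ × _ × _ => t.2.2) ht
    have ht0 : 0 ≤ t.1 := by
      have : t.1 ∈ U.map (·.1) := h1 ▸ Multiset.mem_map_of_mem _ ht
      rw [hU1] at this
      obtain ⟨k, -, hk⟩ := Multiset.mem_map.1 this
      rw [← hk]
      exact hz k
    have hm1 := (hh.mem_hi _).1 ht1
    have hm2 := not_le.1 ((hh.mem_lo _).1 ht2)
    obtain ⟨x, hx, hx'⟩ := List.mem_map.1
      (by rw [ha.map_snd, List.mem_reverse]; exact ht1 : t.2.1 ∈ a.map Prod.snd)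
    obtain ⟨y, hy, hy'⟩ := List.mem_map.1
      (by rw [hb.map_snd, List.mem_reverse]; exact ht2 : t.2.2 ∈ b.map Prod.snd)
    have g1 := ha.ge x hx
    have g2 := hb.ge y hy
    rw [hva x hx, hx', abs_of_nonneg (sub_nonneg.2 hm1)] at g1
    rw [hvb y hy, hy', abs_of_neg (sub_neg.2 hm2)] at g2
    rw [abs_of_pos (sub_pos.2 (hm2.trans_le hm1)), Function.comp_apply, ← mul_div_assoc]
    have hd : 0 < s t.2.1 - s t.2.2 := sub_pos.2 (hm2.trans_le hm1)
    have hle : s t.2.1 - s t.2.2 ≤ lam * (va t.2.1 + vb t.2.2) := by linarith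
    have hd' : 0 < va t.2.1 + vb t.2.2 := by
      by_contra! hneg
      nlinarith
    rw [div_le_div_iff₀ hd' hd]
    nlinarith

theorem exists_solution {n : ℕ} (hn : 0 < n) {s : Fin (2 * n) → ℝ} (hs : Function.Injective s)
    {z : Fin n → ℝ} (hz : ∀ k, 0 ≤ z k) {eps m : ℝ} (heps : 0 < eps) (heps' : eps < 1)
    {hi lo a b : List (ℝ × Fin (2 * n))} (hh : Halves s m hi lo)
    (ha : RoundingOf s m (1 + eps / 4) hi a) (hb : RoundingOf s m (1 + eps / 4) lo b)
    (hbpos : ∀ y ∈ b, 0 < y.1) {zts : List (ℝ × Fin n)}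
    (hzts : zts = ((List.finRange n).map fun k => (z k, k)).insertionSort KeyGE) :
    ∃ st, search (eps / 16) zts [⟨0, a, b, []⟩] = [st] ∧ ∃ A : CameraAssignment n,
      st.out.Perm (List.ofFn fun k => (k, A.fst k, A.snd k)) ∧
      ∀ B : CameraAssignment n, ∑ k, z k / |s (A.fst k) - s (A.snd k)| ≤
        (1 + eps) * ∑ k, z k / |s (B.fst k) - s (B.snd k)| := by
  have hperm : zts.Perm ((List.finRange n).map fun k => (z k, k)) := by
    rw [hzts]; exact List.perm_insertionSort _ _
  have hlen : zts.length = n := by simpa using hperm.length_eq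
  have hal : a.length = n := ha.length_eq.trans hh.hi_length
  have hbl : b.length = n := hb.length_eq.trans hh.lo_length
  have hsorted : (zts.map Prod.fst).Pairwise (· ≥ ·) := by
    rw [List.pairwise_map, hzts]
    exact List.pairwise_insertionSort KeyGE _
  have hopt : ∀ B : CameraAssignment n, ∃ st ∈ search (eps / 16) zts [⟨0, a, b, []⟩],
      (1 - eps / 4) * st.cost ≤
        (1 + eps / 4) * ∑ k, z k / |s (B.fst k) - s (B.snd k)| := by
    intro B
    obtain ⟨T, hT, hTc⟩ := exists_isMatching hs hz (by linarith) hh ha hb hbpos hperm B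
    obtain ⟨st, hst, hc⟩ := exists_mem_search (kappa := eps / 16) (by linarith) (by linarith)
      hsorted (List.mem_singleton_self (⟨0, a, b, []⟩ : SearchState _ _)) hT
      ha.separated.sortedGE hb.separated.sortedGE
    refine ⟨st, hst, le_trans (le_of_eq_of_le ?_ hc) ?_⟩
    · ring
    · simpa using hTc
  have hinit : ∀ st ∈ [(⟨0, a, b, []⟩ : SearchState (Fin (2 * n)) (Fin n))],
      st.Sound s z (hi.map Prod.snd) (lo.map Prod.snd) (List.finRange n) zts := by
    intro st hst
    rw [List.mem_singleton] at hst
    subst hst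
    refine ⟨?_, ?_, ?_, by simp [hal, hlen], by simp [hbl, hlen], ?_, ?_, by simp⟩
    · simp [ha.map_snd]
    · simp [hb.map_snd]
    · have := hperm.map Prod.snd
      rw [List.map_map, show Prod.snd ∘ (fun k => (z k, k)) = id from rfl, List.map_id] at this
      simpa using this
    · intro e he
      obtain ⟨k, -, rfl⟩ := List.mem_map.1 (hperm.mem_iff.1 he)
      exact ⟨rfl, hz k⟩
    · intro x hx y hy
      dsimp only at hx hy
      have h1 := ha.le x hx
      have h2 := hb.le y hy
      have hm1 := (hh.mem_hi x.2).1 (by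
        rw [← List.mem_reverse, ← ha.map_snd]; exact List.mem_map_of_mem hx)
      have hm2 := not_le.1 ((hh.mem_lo y.2).1 (by
        rw [← List.mem_reverse, ← hb.map_snd]; exact List.mem_map_of_mem hy))
      rw [abs_of_nonneg (sub_nonneg.2 hm1)] at h1
      rw [abs_of_neg (sub_neg.2 hm2)] at h2
      rw [abs_of_pos (sub_pos.2 (hm2.trans_le hm1))]
      exact ⟨add_pos_of_nonneg_of_pos (ha.nonneg x hx) (hbpos y hy), by linarith⟩
  obtain ⟨B₀⟩ := nonempty_cameraAssignment n
  obtain ⟨st, hst⟩ := exists_search_eq_singleton (kappa := eps / 16) hinit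
    (by obtain ⟨st, hst, -⟩ := hopt B₀; exact List.ne_nil_of_mem hst)
    (by rintro rfl; simp at hlen; omega)
  have hsound := sound_of_mem_search (kappa := eps / 16) hinit st (by rw [hst]; simp)
  have hl := hsound.length_left
  have hr := hsound.length_right
  rw [List.length_nil, List.length_eq_zero_iff] at hl hr
  have p1 := hsound.left_perm
  have p2 := hsound.right_perm
  have p3 := hsound.targets_perm
  rw [hl, List.map_nil, List.append_nil] at p1
  rw [hr, List.map_nil, List.append_nil] at p2
  rw [List.map_nil, List.append_nil] at p3
  have hall : (hi.map Prod.snd ++ lo.map Prod.snd).Perm (List.finRange (2 * n)) := by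
    refine (List.perm_ext_iff_of_nodup (List.nodup_append.2 ⟨hh.hi_nodup, hh.lo_nodup, ?_⟩)
      (List.nodup_finRange _)).2 fun i => ?_
    · rintro i h1 j h2 rfl
      exact (hh.mem_lo i).1 h2 ((hh.mem_hi i).1 h1)
    · rw [List.mem_append, hh.mem_hi, hh.mem_lo]
      simp [le_or_gt]
  obtain ⟨A, hA⟩ := exists_assignment p3 ((p1.append p2).trans hall)
  refine ⟨st, hst, A, hA, fun B => ?_⟩
  obtain ⟨st', hst', hc⟩ := hopt B
  rw [hst, List.mem_singleton] at hst'
  subst hst'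
  have hcost := hsound.cost_ge
  rw [(hA.map _).sum_eq, List.map_ofFn, List.sum_ofFn] at hcost
  simp only [Function.comp_apply] at hcost
  have hB : 0 ≤ ∑ k, z k / |s (B.fst k) - s (B.snd k)| :=
    Finset.sum_nonneg fun k _ => div_nonneg (hz k) (abs_nonneg _)
  have h1 : (1 - eps / 4) * ∑ k, z k / |s (A.fst k) - s (A.snd k)| ≤
      (1 - eps / 4) * ((1 + eps) * ∑ k, z k / |s (B.fst k) - s (B.snd k)|) := by
    refine (mul_le_mul_of_nonneg_left hcost (by linarith)).trans (hc.trans ?_)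
    rw [← mul_assoc]
    exact mul_le_mul_of_nonneg_right (by nlinarith) hB
  exact le_of_mul_le_mul_left h1 (by linarith)

/-! ## The geometry of the cameras and targets -/

theorem exists_lineMap_coord {n : ℕ} {c : Fin (2 * n) → Plane} (hc : Collinear ℝ (Set.range c))
    {i j : Fin (2 * n)} (hij : c i ≠ c j) (p : Plane) :
    p ∈ affineSpan ℝ (Set.range c) ↔
      ∃ r : ℝ, p 0 = c i 0 + r * (c j 0 - c i 0) ∧ p 1 = c i 1 + r * (c j 1 - c i 1) := by
  rw [← hc.affineSpan_eq_of_ne ⟨i, rfl⟩ ⟨j, rfl⟩ hij,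
    mem_affineSpan_pair_iff_exists_lineMap_eq]
  refine exists_congr fun r => ?_
  rw [AffineMap.lineMap_apply]
  constructor
  · rintro rfl
    simp [add_comm]
  · rintro ⟨h0, h1⟩
    ext k
    fin_cases k
    · simp [h0, add_comm]
    · simp [h1, add_comm]

theorem dist_eq_sqrt (p q : Plane) : dist p q = √((p 0 - q 0) ^ 2 + (p 1 - q 1) ^ 2) := by
  rw [EuclideanSpace.dist_eq, Fin.sum_univ_two, Real.dist_eq, Real.dist_eq, sq_abs, sq_abs]

theorem exists_scale {n : ℕ} {c : Fin (2 * n) → Plane} (hc : Collinear ℝ (Set.range c))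
    {i j : Fin (2 * n)} (hij : c i ≠ c j) {w₀ w₁ : ℝ} (hw₀ : w₀ = c j 0 - c i 0)
    (hw₁ : w₁ = c j 1 - c i 1) :
    ∃ L : ℝ, 0 < L ∧
      (∀ k l, |dotKey w₀ w₁ (c k) - dotKey w₀ w₁ (c l)| = L * dist (c k) (c l)) ∧
      ∀ p, areaKey w₀ w₁ (c i) p = L * depth c p := by
  have hline := fun p => exists_lineMap_coord hc hij p
  rw [← hw₀, ← hw₁] at hline
  have hpos : 0 < w₀ ^ 2 + w₁ ^ 2 := by
    rw [hw₀, hw₁]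
    by_contra! h
    have h0 : c j 0 - c i 0 = 0 := by nlinarith [sq_nonneg (c j 0 - c i 0), sq_nonneg (c j 1 - c i 1)]
    have h1 : c j 1 - c i 1 = 0 := by nlinarith [sq_nonneg (c j 0 - c i 0), sq_nonneg (c j 1 - c i 1)]
    refine hij ?_
    ext k
    fin_cases k
    · exact (sub_eq_zero.1 h0).symm
    · exact (sub_eq_zero.1 h1).symm
  set L := √(w₀ ^ 2 + w₁ ^ 2) with hL
  have hL0 : 0 < L := Real.sqrt_pos.2 hpos
  have hL2 : L * L = w₀ ^ 2 + w₁ ^ 2 := Real.mul_self_sqrt hpos.le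
  refine ⟨L, hL0, fun k l => ?_, fun p => ?_⟩
  · obtain ⟨r, hr0, hr1⟩ := (hline (c k)).1 (subset_affineSpan ℝ _ ⟨k, rfl⟩)
    obtain ⟨u, hu0, hu1⟩ := (hline (c l)).1 (subset_affineSpan ℝ _ ⟨l, rfl⟩)
    have e : dist (c k) (c l) = |r - u| * L := by
      rw [dist_eq_sqrt, hr0, hr1, hu0, hu1, hL, ← Real.sqrt_sq_eq_abs, ← Real.sqrt_mul (sq_nonneg _)]
      congr 1
      ring
    have e' : dotKey w₀ w₁ (c k) - dotKey w₀ w₁ (c l) = (r - u) * (L * L) := by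
      rw [dotKey, dotKey, hr0, hr1, hu0, hu1, hL2]
      ring
    rw [e, e', abs_mul, abs_of_pos (mul_pos hL0 hL0)]
    ring
  · have key : ∀ q : Plane, ∀ r : ℝ, q 0 = c i 0 + r * w₀ → q 1 = c i 1 + r * w₁ →
        (L * dist p q) ^ 2 = areaKey w₀ w₁ (c i) p ^ 2 +
          ((p 0 - c i 0) * w₀ + (p 1 - c i 1) * w₁ - r * (L * L)) ^ 2 := by
      intro q r h0 h1
      rw [areaKey, sq_abs, mul_pow, sq L, hL2, dist_eq_sqrt, Real.sq_sqrt (by positivity), h0, h1]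
      ring
    have harea : 0 ≤ areaKey w₀ w₁ (c i) p := abs_nonneg _
    apply le_antisymm
    · rw [mul_comm, ← div_le_iff₀ hL0, depth,
        Metric.le_infDist ⟨c i, subset_affineSpan ℝ _ (Set.mem_range_self i)⟩]
      intro q hq
      obtain ⟨r, h0, h1⟩ := (hline q).1 hq
      rw [div_le_iff₀ hL0, mul_comm]
      refine (sq_le_sq₀ harea (by positivity)).1 ?_
      rw [key q r h0 h1]
      exact le_add_of_nonneg_right (sq_nonneg _)
    · set r := ((p 0 - c i 0) * w₀ + (p 1 - c i 1) * w₁) / (L * L) with hr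
      set q : Plane := !₂[c i 0 + r * w₀, c i 1 + r * w₁] with hq
      have hqm : q ∈ affineSpan ℝ (Set.range c) := (hline q).2 ⟨r, by simp [hq], by simp [hq]⟩
      refine (mul_le_mul_of_nonneg_left (Metric.infDist_le_dist_of_mem hqm) hL0.le).trans ?_
      refine (sq_le_sq₀ (by positivity) harea).1 ?_
      rw [key q r (by simp [hq]) (by simp [hq]), hr,
        div_mul_cancel₀ _ (mul_pos hL0 hL0).ne']
      simp

/-! ## The running time -/

theorem inv_init {kappa lam : ℝ} {a b : List (ℝ × α)} (ha : Separated lam a)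
    (hb : Separated lam b) (ha' : a ≠ []) (hb' : b ≠ []) :
    (⟨0, a, b, []⟩ : SearchState α β).Inv kappa a b := by
  have key : ∀ l : List (ℝ × α), Separated lam l → l ≠ [] →
      ∃ x ∈ l.map Prod.fst, ∀ e ∈ l, e.1 ≤ x := by
    rintro (_ | ⟨x, l⟩) hl hne
    · exact absurd rfl hne
    · refine ⟨x.1, by simp, fun e he => ?_⟩
      rcases List.mem_cons.1 he with rfl | he
      · exact le_rfl
      · exact ((List.pairwise_cons.1 hl).1 e he).1
  obtain ⟨x, hx, hx'⟩ := key a ha ha'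
  obtain ⟨y, hy, hy'⟩ := key b hb hb'
  exact ⟨x, hx, y, hy, ⟨List.Sublist.refl _, List.prefix_refl _, hx'⟩,
    ⟨List.Sublist.refl _, List.prefix_refl _, hy'⟩⟩

theorem search_time {kappa lam : ℝ} {a b : List (ℝ × α)} {n W : ℕ}
    (ea : α → Val) (eb : β → Val) (hkappa : 0 < kappa) (hlam : 1 < lam) (hkl : kappa ≤ lam)
    (hW : lam / kappa < lam ^ W) (hn : 0 < n) (ha : Separated lam a) (hb : Separated lam b)
    (han : a.length = n) (hbn : b.length = n) (ha0 : ∀ x ∈ a, 0 ≤ x.1) (hb0 : ∀ y ∈ b, 0 < y.1)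
    (zts : List (ℝ × β)) {S : ℕ} (hS : S = n ^ 2 * ((n + 1) ^ (W + 1)) ^ 2) :
    Ev procs [.cons (.num kappa) (.cons (encList eb zts) (encStates ea eb [⟨0, a, b, []⟩]))]
      loopBody (encStates ea eb (search kappa zts [⟨0, a, b, []⟩]))
      ((500 * ((n + 1) ^ 3 * (S * n ^ 2 + 1)) * (S + 1) + 30) * (zts.length + 1)) := by
  refine search_ev ea eb kappa zts _ (Inv := fun sts => (∀ st ∈ sts, st.Inv kappa a b) ∧
    (sts.map SearchState.keys).Nodup) ⟨?_, by simp⟩ (fun zt sts h => ⟨?_, ?_⟩)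
    (fun sts h st hst => (h.1 st hst).valid han.le hbn.le ha0 hb0) (fun sts h => ?_)
  · intro st hst
    rw [List.mem_singleton.1 hst]
    refine inv_init ha hb ?_ ?_
    · rintro rfl; simp at han; omega
    · rintro rfl; simp at hbn; omega
  · exact forall_mem_expandStates fun st hst s hs => (h.1 st hst).expand hkappa.le ha hb hs
  · exact nodup_keys_expandStates _ _ _
  · rw [hS]
    exact length_states_le hkappa hlam ha hb han.le hbn.le ha0 hb0 hW hkl h.1 h.2

theorem time_le {n W S : ℕ} (hS : S = n ^ 2 * ((n + 1) ^ (W + 1)) ^ 2) :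
    100 * (n + 1) ^ 2 + 60 * (2 * n + 1) ^ 2 + 30 * (n + 1) + 60 * (n + 1) + 60 * (n + 1) +
      (500 * ((n + 1) ^ 3 * (S * n ^ 2 + 1)) * (S + 1) + 30) * (n + 1) + 200 ≤
      (n + 2) ^ (4 * W + 32) := by
  have hx : 2 ≤ n + 2 := by omega
  have hx1 : 1 ≤ n + 2 := by omega
  have h2 : ∀ k, 2 ^ k ≤ (n + 2) ^ k := fun k => Nat.pow_le_pow_left hx k
  have hSx : S ≤ (n + 2) ^ (2 * W + 4) := by
    calc S = n ^ 2 * ((n + 1) ^ (W + 1)) ^ 2 := hS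
      _ ≤ (n + 2) ^ 2 * ((n + 2) ^ (W + 1)) ^ 2 := by gcongr <;> omega
      _ = (n + 2) ^ (2 * W + 4) := by ring
  have hpow : ∀ k, 1 ≤ (n + 2) ^ k := fun k => Nat.one_le_pow _ _ hx1
  have hadd : ∀ k, (n + 2) ^ k + (n + 2) ^ k ≤ (n + 2) ^ (k + 1) := fun k => by
    rw [pow_succ]; nlinarith [hpow k]
  have e1 : S + 1 ≤ (n + 2) ^ (2 * W + 5) :=
    (add_le_add hSx (hpow (2 * W + 4))).trans (hadd _)
  have e2 : S * n ^ 2 + 1 ≤ (n + 2) ^ (2 * W + 7) := by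
    refine (add_le_add ?_ (hpow (2 * W + 6))).trans (hadd _)
    calc S * n ^ 2 ≤ (n + 2) ^ (2 * W + 4) * (n + 2) ^ 2 := by gcongr; omega
      _ = _ := by ring
  have e3 : 500 * ((n + 1) ^ 3 * (S * n ^ 2 + 1)) * (S + 1) ≤ (n + 2) ^ (4 * W + 24) := by
    calc _ ≤ (n + 2) ^ 9 * ((n + 2) ^ 3 * (n + 2) ^ (2 * W + 7)) * (n + 2) ^ (2 * W + 5) := by
          gcongr
          · exact le_trans (by norm_num) (h2 9)
          · omega
      _ = _ := by ring
  have mono : ∀ {k l : ℕ}, k ≤ l → (n + 2) ^ k ≤ (n + 2) ^ l := fun h => Nat.pow_le_pow_right hx1 h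
  have e4 : (500 * ((n + 1) ^ 3 * (S * n ^ 2 + 1)) * (S + 1) + 30) * (n + 1) ≤
      (n + 2) ^ (4 * W + 26) := by
    calc _ ≤ ((n + 2) ^ (4 * W + 24) + (n + 2) ^ (4 * W + 24)) * (n + 2) := by
          gcongr
          · exact le_trans (by norm_num) ((h2 5).trans (mono (by omega)))
          · omega
      _ ≤ (n + 2) ^ (4 * W + 25) * (n + 2) := by gcongr; exact hadd _
      _ = _ := by ring
  have e5 : 100 * (n + 1) ^ 2 ≤ (n + 2) ^ (4 * W + 26) := by
    calc 100 * (n + 1) ^ 2 ≤ (n + 2) ^ 7 * (n + 2) ^ 2 := by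
          gcongr
          · exact le_trans (by norm_num) (h2 7)
          · omega
      _ = (n + 2) ^ 9 := by ring
      _ ≤ _ := mono (by omega)
  have e6 : 60 * (2 * n + 1) ^ 2 ≤ (n + 2) ^ (4 * W + 26) := by
    calc 60 * (2 * n + 1) ^ 2 ≤ (n + 2) ^ 6 * ((n + 2) * (n + 2)) ^ 2 := by
          gcongr
          · exact le_trans (by norm_num) (h2 6)
          · nlinarith
      _ = (n + 2) ^ 10 := by ring
      _ ≤ _ := mono (by omega)
  have e7 : 60 * (n + 1) ≤ (n + 2) ^ (4 * W + 26) := by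
    calc 60 * (n + 1) ≤ (n + 2) ^ 6 * (n + 2) := by
          gcongr
          · exact le_trans (by norm_num) (h2 6)
          · omega
      _ = (n + 2) ^ 7 := by ring
      _ ≤ _ := mono (by omega)
  have e8 : 200 ≤ (n + 2) ^ (4 * W + 26) :=
    le_trans (by norm_num) ((h2 8).trans (mono (by omega)))
  have f1 := hadd (4 * W + 26)
  have f2 := hadd (4 * W + 27)
  have f3 := hadd (4 * W + 28)
  have f4 : (n + 2) ^ (4 * W + 29) ≤ (n + 2) ^ (4 * W + 32) := mono (by omega)
  simp only [add_assoc, Nat.reduceAdd] at f1 f2 f3 ⊢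
  omega

theorem program_runs_empty (eps : ℝ) (c : Fin (2 * 0) → Plane) (t : Fin 0 → Plane) :
    Ev procs [encodeInput eps c t] mainExpr .nil 8 := by
  apply Ev.mono
  · exact Ev.split_cons (Ev.var rfl) (Ev.split_cons (Ev.var rfl) (Ev.split_nil (Ev.var rfl) Ev.nil))
  · norm_num

theorem program_runs {eps : ℝ} (heps : 0 < eps) (heps' : eps < 1) {W : ℕ}
    (hW : (1 + eps / 4) / (eps / 16) < (1 + eps / 4) ^ W) {n : ℕ} (hn : 0 < n)
    {c : Fin (2 * n) → Plane} (t : Fin n → Plane) (hc : Function.Injective c)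
    (hcol : Collinear ℝ (Set.range c)) :
    ∃ (out : List (Fin n × Fin (2 * n) × Fin (2 * n))) (A : CameraAssignment n),
      Ev procs [encodeInput eps c t] mainExpr
        (encOut (fun i => Val.ofPoint (c i)) (fun k => Val.ofPoint (t k)) out)
        ((n + 2) ^ (4 * W + 32)) ∧
      out.Perm (List.ofFn fun k => (k, A.fst k, A.snd k)) ∧
      ∀ B : CameraAssignment n, sumOfRatios c t A ≤ (1 + eps) * sumOfRatios c t B := by
  obtain ⟨i, j, is, his⟩ : ∃ i j is, List.finRange (2 * n) = i :: j :: is := by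
    match h : List.finRange (2 * n) with
    | [] =>
      have := congrArg List.length h
      rw [List.length_finRange] at this
      simp only [List.length_nil] at this
      omega
    | [i] =>
      have := congrArg List.length h
      rw [List.length_finRange] at this
      simp only [List.length_cons, List.length_nil] at this
      omega
    | i :: j :: is => exact ⟨i, j, is, rfl⟩
  have hij : c i ≠ c j := by
    have := List.nodup_finRange (2 * n)
    rw [his] at this
    refine fun h => (List.nodup_cons.1 this).1 ?_
    rw [hc h]
    simp
  set w₀ := c j 0 - c i 0 with hw₀
  set w₁ := c j 1 - c i 1 with hw₁
  obtain ⟨L, hL, hdist, hdepth⟩ := exists_scale hcol hij hw₀ hw₁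
  set s : Fin (2 * n) → ℝ := fun k => dotKey w₀ w₁ (c k) with hs_def
  set z : Fin n → ℝ := fun k => areaKey w₀ w₁ (c i) (t k) with hz_def
  have hs : Function.Injective s := by
    intro k l hkl
    have := hdist k l
    rw [show dotKey w₀ w₁ (c k) = dotKey w₀ w₁ (c l) from hkl, sub_self, abs_zero, eq_comm,
      mul_eq_zero, dist_eq_zero] at this
    exact hc (this.resolve_left hL.ne')
  have hsum : ∀ A : CameraAssignment n,
      ∑ k, z k / |s (A.fst k) - s (A.snd k)| = sumOfRatios c t A := fun A =>
    Finset.sum_congr rfl fun k _ => by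
      rw [hdist, show z k = L * depth c (t k) from hdepth _, mul_div_mul_left _ _ hL.ne']
  set cams := ((List.finRange (2 * n)).map fun i => (s i, i)).insertionSort KeyGE with hcams
  set zts := ((List.finRange n).map fun k => (z k, k)).insertionSort KeyGE with hzts
  obtain ⟨e, hi', hhi', hh⟩ := exists_halves hn hs hcams rfl rfl
  set hi := (cams.take n).reverse with hhi
  set lo := cams.drop n with hlo
  have ha := roundingOf (lam := 1 + eps / 4) (by linarith) hh.hi_pairwise hh.hi_fst
  have hb := roundingOf (lam := 1 + eps / 4) (by linarith) hh.lo_pairwise hh.lo_fst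
  have hbpos : ∀ y ∈ roundList e.1 (1 + eps / 4) 0 lo [], 0 < y.1 := by
    intro y hy
    have hy2 := not_le.1 ((hh.mem_lo y.2).1 (by
      rw [← List.mem_reverse, ← hb.map_snd]; exact List.mem_map_of_mem hy))
    have := (abs_pos.2 (sub_neg.2 hy2).ne).trans_le (hb.ge y hy)
    exact pos_of_mul_pos_right this (by linarith)
  obtain ⟨st, hst, A, hA, hopt⟩ := exists_solution hn hs (fun k => abs_nonneg _) heps heps' hh ha hb
    hbpos hzts
  have htime := search_time (fun i => Val.ofPoint (c i)) (fun k => Val.ofPoint (t k))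
    (kappa := eps / 16) (by linarith) (by linarith) (by linarith) hW hn ha.separated hb.separated
    (ha.length_eq.trans hh.hi_length) (hb.length_eq.trans hh.lo_length) ha.nonneg hbpos zts rfl
  have hzlen : zts.length = n := by simp [hzts]
  refine ⟨st.out, A, ?_, hA, fun B => ?_⟩
  · have hmain := main_ev eps c t i j is (List.finRange n) hw₀ hw₁ (cams := cams) (hi := hi)
      (lo := lo) (hi' := hi') (zts := zts) (e := e) (by rw [← his]) rfl
      (by rw [← his]; simp; omega) (by simp [hhi]) hhi' (by simp [hlo]) hst htime
    rw [← his, ← List.ofFn_eq_map, ← List.ofFn_eq_map] at hmain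
    refine hmain.mono (le_trans (le_of_eq ?_) (time_le rfl))
    rw [List.length_finRange, List.length_finRange, hh.hi_length, hh.lo_length, hzlen]
  · rw [← hsum, ← hsum]
    exact hopt B

end CameraProgram

theorem mainTheorem2 :
    ∃ (P : Program) (d : ℕ), ∀ ε : ℝ, 0 < ε → ε < 1 →
      ∃ C : ℝ, ∀ (n : ℕ) (c : Fin (2 * n) → Plane) (t : Fin n → Plane),
        Function.Injective c → Collinear ℝ (Set.range c) →
          ∃ (v : Val) (s : ℕ) (A : CameraAssignment n),
            P.Runs (encodeInput ε c t) v s ∧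
            (s : ℝ) ≤ ((n : ℝ) + 2) ^ (C * Real.log ((n : ℝ) + 2) ^ d) ∧
            IsOutput c t A v ∧
            ∀ B : CameraAssignment n,
              sumOfRatios c t A ≤ (1 + ε) * sumOfRatios c t B := by
  refine ⟨CameraProgram.program, 0, fun ε hε hε' => ?_⟩
  obtain ⟨W, hW⟩ := pow_unbounded_of_one_lt ((1 + ε / 4) / (ε / 16))
    (by linarith : (1 : ℝ) < 1 + ε / 4)
  refine ⟨(4 * W + 32 : ℕ), fun n c t hc hcol => ?_⟩
  have hbound : ∀ s : ℕ, s ≤ (n + 2) ^ (4 * W + 32) →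
      (s : ℝ) ≤ ((n : ℝ) + 2) ^ (((4 * W + 32 : ℕ) : ℝ) * Real.log ((n : ℝ) + 2) ^ 0) := by
    intro s hs
    rw [pow_zero, mul_one, Real.rpow_natCast]
    exact_mod_cast hs
  rcases n.eq_zero_or_pos with rfl | hn
  · obtain ⟨s, hs, hev⟩ := CameraProgram.program_runs_empty ε c t
    obtain ⟨A⟩ := CameraProgram.nonempty_cameraAssignment 0
    refine ⟨.nil, s, A, hev, hbound s (hs.trans ?_), ⟨[], by simp, rfl⟩, fun B => ?_⟩
    · calc 8 ≤ 2 ^ 32 := by norm_num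
        _ ≤ (0 + 2) ^ (4 * W + 32) := Nat.pow_le_pow_right (by norm_num) (by omega)
    · simp [sumOfRatios]
  · obtain ⟨out, A, ⟨s, hs, hev⟩, hA, hopt⟩ := CameraProgram.program_runs hε hε' hW hn t hc hcol
    refine ⟨_, s, A, hev, hbound s hs, ⟨_, ?_, rfl⟩, hopt⟩
    have := hA.map fun x : Fin n × Fin (2 * n) × Fin (2 * n) => Val.cons (Val.ofPoint (t x.1))
      (Val.cons (Val.ofPoint (c x.2.1)) (Val.ofPoint (c x.2.2)))
    rwa [List.map_ofFn] at this
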